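/- Let $n\ge 1$, let $|\cdot|$ be the Euclidean norm on $\mathbb R^n$ and $\mathbb S^{n-1}$ its unit sphere. Let $A$ be a real $n\times n$ matrix that is diagonalizable over $\mathbb R$ and has only positive eigenvalues. Let $\alpha>0$, and let $H:\mathbb R^n\setminus\{0\}\to\mathbb R$ satisfy $H(sx)=s^{\alpha}H(x)$ for all $s>0$, $x\ne 0$, and be positive and continuous on $\mathbb S^{n-1}$. Let $0\le t_0<T_*<\infty$, and let $G:[t_0,\infty)\times(\mathbb R^n\setminus\{0\})\to\mathbb R^n$ be continuous. Suppose that $y\in C^1([t_0,T_*),\mathbb R^n\setminus\{0\})$ satisfies $$y'(t)=H(y(t))\,Ay(t)+G(t,y(t))\quad\text{for } t\in(t_0,T_*),\qquad \lim_{t\to T_*^-}|y(t)|=\infty .$$ Consider the following two cases. Case 1. For every $x_0\in\mathbb S^{n-1}$ there are $r,C,\gamma>0$ such that $|H(x)-H(x_0)|\le C|x-x_0|^{\gamma}$ for all $x\in\mathbb S^{n-1}$ with $|x-x_0|<r$; and there are $M,\delta>0$ and $r_*>1$ such that $|G(t,x)|\le M|x|^{1+\alpha-\delta}$ for all $t\ge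 t_0$ and $|x|\ge r_*$. Case 2. There is $\gamma\in(0,1]$ such that for every $x_0\in\mathbb S^{n-1}$ there are $r,C>0$ such that $|H(x)-H(x_0)|\le C|x-x_0|^{\gamma}$ for all $x\in\mathbb S^{n-1}$ with $|x-x_0|<r$; and there are $M>0$, $r_*>e$ and $p>1+1/\gamma$ such that $|G(t,x)|\le M|x|^{1+\alpha}(\ln|x|)^{-p}$ for all $t\ge t_0$ and $|x|\ge r_*$. Then in each of the two cases there exist an eigenvalue $\Lambda$ of $A$ and an eigenvector $\xi_*$ of $A$ associated with $\Lambda$ such that $\alpha\Lambda H(\xi_*)=1$ and, as $t\to T_*^-$, $$\bigl|(T_*-t)^{1/\alpha}y(t)-\xi_*\bigr|=\mathcal O\bigl((T_*-t)^{\varepsilon_*}\bigr)\ \text{ for some } \varepsilon_*>0 \text{ in Case 1},$$ $$\bigl|(T_*-t)^{1/\alpha}y(t)-\xi_*\bigr|=\mathcal O\bigl(|\ln(T_*-t)|^{-p_*}\bigr)\ \text{ for some } p_*>0 \text{ in Case 2}.$$ -/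

import Mathlib

open Set Filter Topology Asymptotics

/-- `F`, restricted to the nonzero vectors, is positively homogeneous of degree `β`. The value
`F 0` is irrelevant. -/
def PosHomogeneous {X Y : Type*} [AddCommGroup X] [Module ℝ X] [AddCommGroup Y] [Module ℝ Y]
    (β : ℝ) (F : X → Y) : Prop :=
  ∀ x : X, x ≠ 0 → ∀ t : ℝ, 0 < t → F (t • x) = t ^ β • F x

/-- A real square matrix is diagonalizable over `ℝ`. -/
def MatrixDiagonalizable {n : ℕ} (A : Matrix (Fin n) (Fin n) ℝ) : Prop :=
  ∃ (S : Matrix (Fin n) (Fin n) ℝ) (d : Fin n → ℝ),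
    IsUnit S ∧ A = S⁻¹ * Matrix.diagonal d * S

/-- `A` is diagonalizable over `ℝ` and all its eigenvalues are positive. -/
def DiagonalizablePositive {n : ℕ} (A : Matrix (Fin n) (Fin n) ℝ) : Prop :=
  MatrixDiagonalizable A ∧
    ∀ μ : ℝ, Module.End.HasEigenvalue (Matrix.toEuclideanLin A) μ → 0 < μ

/-- The standing condition on `H`: positively homogeneous of degree `α` off the origin, and
positive and continuous on the unit sphere. -/
structure IsRateFunction {n : ℕ} (α : ℝ) (H : EuclideanSpace ℝ (Fin n) → ℝ) : Prop where
  homogeneous : PosHomogeneous α H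
  pos_sphere : ∀ x ∈ Metric.sphere (0 : EuclideanSpace ℝ (Fin n)) 1, 0 < H x
  continuousOn_sphere : ContinuousOn H (Metric.sphere (0 : EuclideanSpace ℝ (Fin n)) 1)

/-- Pointwise Hölder estimate of `F` on `E` at the point `x₀`, with power `γ`. -/
def HolderAtOn {n : ℕ} (F : EuclideanSpace ℝ (Fin n) → ℝ) (E : Set (EuclideanSpace ℝ (Fin n)))
    (x₀ : EuclideanSpace ℝ (Fin n)) (γ : ℝ) : Prop :=
  ∃ r C : ℝ, 0 < r ∧ 0 < C ∧ ∀ x ∈ E, ‖x - x₀‖ < r → |F x - F x₀| ≤ C * ‖x - x₀‖ ^ γ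

/-- Property (HC) on `E`; the power may depend on the point. -/
def PropertyHC {n : ℕ} (F : EuclideanSpace ℝ (Fin n) → ℝ)
    (E : Set (EuclideanSpace ℝ (Fin n))) : Prop :=
  ∀ x₀ ∈ E, ∃ γ : ℝ, 0 < γ ∧ HolderAtOn F E x₀ γ

/-- Property (HC) on `E` with the same power `γ` at all points (the radius and the constant may
depend on the point). -/
def PropertyHCWith {n : ℕ} (F : EuclideanSpace ℝ (Fin n) → ℝ)
    (E : Set (EuclideanSpace ℝ (Fin n))) (γ : ℝ) : Prop :=
  ∀ x₀ ∈ E, HolderAtOn F E x₀ γ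

/-- `G` is continuous on `[t₀, ∞) × (ℝⁿ ∖ {0})`. -/
def ContinuousForcing {n : ℕ} (t₀ : ℝ)
    (G : ℝ → EuclideanSpace ℝ (Fin n) → EuclideanSpace ℝ (Fin n)) : Prop :=
  ContinuousOn (fun q : ℝ × EuclideanSpace ℝ (Fin n) => G q.1 q.2)
    (Ici t₀ ×ˢ {x : EuclideanSpace ℝ (Fin n) | x ≠ 0})

/-- Case 1: power-type bound on `G`. -/
def PowerCase {n : ℕ} (α t₀ : ℝ) (H : EuclideanSpace ℝ (Fin n) → ℝ)
    (G : ℝ → EuclideanSpace ℝ (Fin n) → EuclideanSpace ℝ (Fin n)) : Prop :=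
  PropertyHC H (Metric.sphere 0 1) ∧ ContinuousForcing t₀ G ∧
    ∃ M δ r : ℝ, 0 < M ∧ 0 < δ ∧ 1 < r ∧
      ∀ t : ℝ, t₀ ≤ t → ∀ x : EuclideanSpace ℝ (Fin n), r ≤ ‖x‖ →
        ‖G t x‖ ≤ M * ‖x‖ ^ (1 + α - δ)

/-- Case 2: logarithmic bound on `G`. -/
def LogCase {n : ℕ} (α t₀ : ℝ) (H : EuclideanSpace ℝ (Fin n) → ℝ)
    (G : ℝ → EuclideanSpace ℝ (Fin n) → EuclideanSpace ℝ (Fin n)) : Prop :=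
  ∃ γ : ℝ, 0 < γ ∧ γ ≤ 1 ∧
    PropertyHCWith H (Metric.sphere 0 1) γ ∧ ContinuousForcing t₀ G ∧
    ∃ M r p : ℝ, 0 < M ∧ Real.exp 1 < r ∧ 1 + 1 / γ < p ∧
      ∀ t : ℝ, t₀ ≤ t → ∀ x : EuclideanSpace ℝ (Fin n), r ≤ ‖x‖ →
        ‖G t x‖ ≤ M * ‖x‖ ^ (1 + α) / (Real.log ‖x‖) ^ p

/-- `y ∈ C¹([t₀, T), ℝⁿ ∖ {0})` solves `y' = H(y) A y + G(t, y)` on `(t₀, T)` and `|y(t)| → ∞`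
as `t → T⁻`. -/
structure IsBlowUpSolution {n : ℕ} (A : Matrix (Fin n) (Fin n) ℝ)
    (H : EuclideanSpace ℝ (Fin n) → ℝ)
    (G : ℝ → EuclideanSpace ℝ (Fin n) → EuclideanSpace ℝ (Fin n))
    (t₀ T : ℝ) (y : ℝ → EuclideanSpace ℝ (Fin n)) : Prop where
  contDiffOn : ContDiffOn ℝ 1 y (Ico t₀ T)
  ne_zero : ∀ t ∈ Ico t₀ T, y t ≠ 0
  hasDerivAt : ∀ t ∈ Ioo t₀ T,
    HasDerivAt y (H (y t) • Matrix.toEuclideanLin A (y t) + G t (y t)) t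
  blowUp : Tendsto (fun t => ‖y t‖) (𝓝[<] T) atTop

/-! Diagonalize `A` by a linear change of variables `B`, put z = By, and use polar coordinates: the
logarithmic clock θ = log |z| and the direction w = z/|z|. Since |z| → ∞ and the diagonal entries
are positive, θ is eventually strictly increasing in t and can replace time. Homogeneity of `H`
cancels the size of the solution, so w solves the projected diagonal flow w_i' = (d_i/Q(w) - 1) w_i
up to an error O(φ(θ)), where Q(w) = Σ d_i w_i², and φ is exponential in Case 1 and a power θ^(-p)
in Case 2. Both are integrable; Φ denotes the tail integral.

Along the unperturbed flow Q is nondecreasing, with Q' = (2/Q) Σ (d_i - Q)² w_i². The integrable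
error does not spoil this, so Q(w) converges, and the limit must be some d_k
(`exists_tendsto_diagForm`). The coordinates with d_i ≠ d_k then satisfy scalar linear equations
that are uniformly stable or unstable, hence are O(φ) (`exists_abs_le_of_stable`,
`abs_le_of_unstable`). This gives Q(w) - d_k = O(φ), so the other coordinates have derivative O(φ)
too, and w converges with error O(Φ) to a vector L with L_i = 0 unless d_i = d_k
(`exists_isBigO_sub_eigenvector`).

Finally dt/dθ is e^(-αθ) times a factor that converges with error O(Φ^γ) by the Hölder property.
Integrating from θ to ∞ gives (T - t) e^(αθ) = c + O(Φ^γ) (`isBigO_remaining_time`), and y = e^θ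
B⁻¹w yields the profile c^(1/α) B⁻¹L. The relation T - t ~ c e^(-αθ) turns the rate in θ into a rate
in T - t. -/

/-! ### Calculus near infinity: tail estimates, scalar linear equations, inverse functions. -/

theorem monotoneOn_Ici_of_hasDerivAt_nonneg {f f' : ℝ → ℝ} {a : ℝ}
    (hf : ∀ x, a ≤ x → HasDerivAt f (f' x) x) (hf' : ∀ x, a ≤ x → 0 ≤ f' x) :
    MonotoneOn f (Ici a) := by
  refine monotoneOn_of_deriv_nonneg (convex_Ici a)
    (fun x hx => (hf x hx).continuousAt.continuousWithinAt)
    (fun x hx => (hf x (interior_subset hx)).differentiableAt.differentiableWithinAt) ?_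
  intro x hx
  rw [(hf x (interior_subset hx)).deriv]
  exact hf' x (interior_subset hx)

theorem antitoneOn_Ici_of_hasDerivAt_nonpos {f f' : ℝ → ℝ} {a : ℝ}
    (hf : ∀ x, a ≤ x → HasDerivAt f (f' x) x) (hf' : ∀ x, a ≤ x → f' x ≤ 0) :
    AntitoneOn f (Ici a) := by
  have h := monotoneOn_Ici_of_hasDerivAt_nonneg (f := fun x => -f x) (f' := fun x => -f' x)
    (fun x hx => (hf x hx).neg) (fun x hx => neg_nonneg.2 (hf' x hx))
  intro x hx y hy hxy
  exact neg_le_neg_iff.1 (h hx hy hxy)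

/-- A function whose derivative is dominated by minus the derivative of a function `Φ` vanishing
at infinity converges, and `Φ` bounds the distance to the limit. -/
theorem exists_tendsto_of_norm_deriv_le {E : Type*} [NormedAddCommGroup E] [NormedSpace ℝ E]
    [CompleteSpace E] {f f' : ℝ → E} {Φ Φ' : ℝ → ℝ}
    (hf : ∀ᶠ x in atTop, HasDerivAt f (f' x) x)
    (hΦ : ∀ᶠ x in atTop, HasDerivAt Φ (Φ' x) x)
    (hle : ∀ᶠ x in atTop, ‖f' x‖ ≤ -Φ' x) (hlim : Tendsto Φ atTop (𝓝 0)) :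
    ∃ L, Tendsto f atTop (𝓝 L) ∧ ∀ᶠ x in atTop, ‖f x - L‖ ≤ Φ x := by
  obtain ⟨a, ha⟩ := eventually_atTop.1 (hf.and (hΦ.and hle))
  have key : ∀ x y, a ≤ x → x ≤ y → ‖f y - f x‖ ≤ Φ x - Φ y := by
    intro x y hx hxy
    refine image_norm_le_of_norm_deriv_right_le_deriv_boundary' (a := x) (b := y)
      (f := fun u => f u - f x) (f' := f') (B := fun u => Φ x - Φ u) (B' := fun u => -Φ' u)
      ?_ ?_ ?_ ?_ ?_ ?_ (right_mem_Icc.2 hxy)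
    · intro u hu
      exact ((ha u (hx.trans hu.1)).1.continuousAt.continuousWithinAt).sub
        continuousWithinAt_const
    · intro u hu
      exact ((ha u (hx.trans hu.1)).1.sub_const _).hasDerivWithinAt
    · simp
    · intro u hu
      exact ((ha u (hx.trans hu.1)).2.1.const_sub _).continuousAt.continuousWithinAt
    · intro u hu
      exact ((ha u (hx.trans hu.1)).2.1.const_sub _).hasDerivWithinAt
    · intro u hu
      exact (ha u (hx.trans hu.1)).2.2
  have hΦ0 : ∀ x, a ≤ x → 0 ≤ Φ x := by
    intro x hx
    refine le_of_tendsto hlim ?_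
    filter_upwards [eventually_ge_atTop x] with y hy
    have := (norm_nonneg _).trans (key x y hx hy)
    linarith
  -- Freezing `f` to the left of `a` makes the Cauchy bound valid for every index.
  have hC : CauchySeq fun x => f (max x a) := by
    refine cauchySeq_of_le_tendsto_0 (fun N => 2 * Φ (max N a)) ?_ ?_
    · intro x y N hx hy
      have h1 := key (max N a) (max x a) (le_max_right _ _) (max_le_max_right a hx)
      have h2 := key (max N a) (max y a) (le_max_right _ _) (max_le_max_right a hy)
      have h3 := hΦ0 (max x a) (le_max_right _ _)
      have h4 := hΦ0 (max y a) (le_max_right _ _)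
      have h5 := dist_triangle_right (f (max x a)) (f (max y a)) (f (max N a))
      rw [dist_eq_norm, dist_eq_norm, dist_eq_norm] at h5
      rw [dist_eq_norm]
      linarith
    · have : Tendsto (fun N : ℝ => max N a) atTop atTop :=
        tendsto_atTop_mono (fun N => le_max_left N a) tendsto_id
      simpa using (hlim.comp this).const_mul 2
  obtain ⟨L, hL⟩ := cauchySeq_tendsto_of_complete hC
  have hfL : Tendsto f atTop (𝓝 L) := by
    refine hL.congr' ?_
    filter_upwards [eventually_ge_atTop a] with x hx
    rw [max_eq_left hx]
  refine ⟨L, hfL, ?_⟩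
  filter_upwards [eventually_ge_atTop a] with x hx
  have h1 : Tendsto (fun y => ‖f x - f y‖) atTop (𝓝 ‖f x - L‖) :=
    (tendsto_const_nhds.sub hfL).norm
  refine le_of_tendsto h1 ?_
  filter_upwards [eventually_ge_atTop x] with y hy
  have h2 := key x y hx hy
  have h3 := hΦ0 y (hx.trans hy)
  rw [norm_sub_rev]
  linarith

/-- A bounded solution of an unstable linear equation is controlled by the forcing. -/
theorem abs_le_of_unstable {w a e φ φ' : ℝ → ℝ} {κ K B : ℝ} (hκ : 0 < κ) (hK : 0 ≤ K)
    (hw : ∀ᶠ x in atTop, HasDerivAt w (a x * w x + e x) x)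
    (ha : ∀ᶠ x in atTop, κ ≤ a x) (he : ∀ᶠ x in atTop, |e x| ≤ K * φ x)
    (hB : ∀ᶠ x in atTop, |w x| ≤ B) (hφ : ∀ᶠ x in atTop, 0 < φ x)
    (hφd : ∀ᶠ x in atTop, HasDerivAt φ (φ' x) x) (hφ' : ∀ᶠ x in atTop, φ' x ≤ 0) :
    ∀ᶠ x in atTop, |w x| ≤ K / κ * φ x := by
  obtain ⟨b, hb⟩ := eventually_atTop.1
    (hw.and (ha.and (he.and (hB.and (hφ.and (hφd.and hφ'))))))
  set M : ℝ := (K / κ) ^ 2 with hM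
  set u : ℝ → ℝ := fun x => w x ^ 2 - M * φ x ^ 2 with hu
  -- This says u' ≥ κu: as φφ' ≤ 0, the difference u' - κu is at least κ(|w| - (K/κ)φ)². If u were
  -- positive somewhere, it would grow like e^(κx), against the bound on w.
  have hmono : MonotoneOn (fun x => u x * Real.exp (-κ * x)) (Ici b) := by
    refine monotoneOn_Ici_of_hasDerivAt_nonneg (f' := fun x =>
      (2 * w x * (a x * w x + e x) - M * (2 * φ x * φ' x)) * Real.exp (-κ * x)
        + u x * (Real.exp (-κ * x) * (-κ))) ?_ ?_
    · intro x hx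
      obtain ⟨h1, -, -, -, -, h2, -⟩ := hb x hx
      have h3 : HasDerivAt u (2 * w x * (a x * w x + e x) - M * (2 * φ x * φ' x)) x := by
        have := (h1.pow 2).sub ((h2.pow 2).const_mul M)
        refine this.congr_deriv ?_
        simp
      have h4 : HasDerivAt (fun x : ℝ => Real.exp (-κ * x)) (Real.exp (-κ * x) * (-κ)) x := by
        simpa using ((hasDerivAt_id x).const_mul (-κ)).exp
      exact h3.mul h4
    · intro x hx
      obtain ⟨-, h1, h2, -, h3, -, h4⟩ := hb x hx
      have h5 : -(K * φ x) * |w x| ≤ e x * w x := by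
        have : |e x * w x| ≤ K * φ x * |w x| := by
          rw [abs_mul]; exact mul_le_mul_of_nonneg_right h2 (abs_nonneg _)
        linarith [neg_abs_le (e x * w x)]
      have h6 : κ * w x ^ 2 ≤ a x * w x ^ 2 := mul_le_mul_of_nonneg_right h1 (sq_nonneg _)
      have h7 : 0 ≤ M * (φ x * (-φ' x)) := by
        refine mul_nonneg (sq_nonneg _) (mul_nonneg h3.le (by linarith))
      have h8 : 0 ≤ κ * (|w x| - K / κ * φ x) ^ 2 := mul_nonneg hκ.le (sq_nonneg _)
      have h9 : κ * (|w x| - K / κ * φ x) ^ 2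
          = κ * w x ^ 2 - 2 * (K * φ x) * |w x| + κ * (M * φ x ^ 2) := by
        rw [hM, sub_sq, sq_abs]; field_simp
      have h10 : 0 ≤ 2 * w x * (a x * w x + e x) - M * (2 * φ x * φ' x) - κ * u x := by
        simp only [hu]; nlinarith
      have := mul_nonneg h10 (Real.exp_pos (-κ * x)).le
      nlinarith
  filter_upwards [eventually_ge_atTop b] with x hx
  have hux : u x ≤ 0 := by
    by_contra! hpos
    have hlim : Tendsto (fun y : ℝ => B ^ 2 * Real.exp (-κ * y)) atTop (𝓝 0) := by
      have : Tendsto (fun y : ℝ => -κ * y) atTop atBot :=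
        tendsto_id.const_mul_atTop_of_neg (by linarith)
      simpa using (Real.tendsto_exp_atBot.comp this).const_mul (B ^ 2)
    have : u x * Real.exp (-κ * x) ≤ 0 := by
      refine ge_of_tendsto hlim ?_
      filter_upwards [eventually_ge_atTop x] with y hy
      refine (hmono hx (hx.trans hy) hy).trans ?_
      refine mul_le_mul_of_nonneg_right ?_ (Real.exp_pos _).le
      have h1 := (hb y (hx.trans hy)).2.2.2.1
      have h2 : w y ^ 2 ≤ B ^ 2 := sq_le_sq' (by linarith [neg_abs_le (w y)])
        ((le_abs_self _).trans h1)
      have h3 : 0 ≤ M * φ y ^ 2 := by positivity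
      simp only [hu]; linarith
    have := mul_pos hpos (Real.exp_pos (-κ * x))
    linarith
  have h1 : 0 ≤ K / κ * φ x := mul_nonneg (by positivity) (hb x hx).2.2.2.2.1.le
  refine abs_le_of_sq_le_sq ?_ h1
  simp only [hu, hM] at hux
  rw [mul_pow]; linarith

/-- A solution of a stable linear equation is controlled by a forcing of slow decay. -/
theorem exists_abs_le_of_stable {w a e φ φ' : ℝ → ℝ} {κ K : ℝ} (hκ : 0 < κ)
    (hw : ∀ᶠ x in atTop, HasDerivAt w (a x * w x + e x) x)
    (ha : ∀ᶠ x in atTop, a x ≤ -(4 * κ)) (he : ∀ᶠ x in atTop, |e x| ≤ K * φ x)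
    (hφ : ∀ᶠ x in atTop, 0 < φ x)
    (hφd : ∀ᶠ x in atTop, HasDerivAt φ (φ' x) x) (hφ' : ∀ᶠ x in atTop, -(κ * φ x) ≤ φ' x) :
    ∃ M, ∀ᶠ x in atTop, |w x| ≤ M * φ x := by
  obtain ⟨b, hb⟩ := eventually_atTop.1
    (hw.and (ha.and (he.and (hφ.and (hφd.and hφ')))))
  -- The first entry lets κN dominate the forcing constant, the second gives u(b) ≤ 0. Then u' ≤
  -- -4κu keeps u ≤ 0; the rate 4κ leaves room for the forcing and for the decay of φ.
  set N : ℝ := max (|K| / κ) (|w b| / φ b) with hN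
  have hN0 : 0 ≤ N := le_trans (by positivity) (le_max_left _ _)
  have hNK : K ≤ κ * N := by
    have : |K| / κ ≤ N := le_max_left _ _
    rw [div_le_iff₀ hκ] at this
    linarith [le_abs_self K]
  set u : ℝ → ℝ := fun x => w x ^ 2 - N ^ 2 * φ x ^ 2 with hu
  have hub : u b ≤ 0 := by
    have h1 : |w b| / φ b ≤ N := le_max_right _ _
    rw [div_le_iff₀ (hb b le_rfl).2.2.2.1] at h1
    have h2 : |w b| ^ 2 ≤ (N * φ b) ^ 2 := pow_le_pow_left₀ (abs_nonneg _) h1 2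
    rw [sq_abs] at h2
    simp only [hu]; nlinarith
  have hmono : AntitoneOn (fun x => u x * Real.exp (4 * κ * x)) (Ici b) := by
    refine antitoneOn_Ici_of_hasDerivAt_nonpos (f' := fun x =>
      (2 * w x * (a x * w x + e x) - N ^ 2 * (2 * φ x * φ' x)) * Real.exp (4 * κ * x)
        + u x * (Real.exp (4 * κ * x) * (4 * κ))) ?_ ?_
    · intro x hx
      obtain ⟨h1, -, -, -, h2, -⟩ := hb x hx
      have h3 : HasDerivAt u (2 * w x * (a x * w x + e x) - N ^ 2 * (2 * φ x * φ' x)) x := by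
        have := (h1.pow 2).sub ((h2.pow 2).const_mul (N ^ 2))
        refine this.congr_deriv ?_
        simp
      have h4 : HasDerivAt (fun x : ℝ => Real.exp (4 * κ * x)) (Real.exp (4 * κ * x) * (4 * κ)) x := by
        simpa using ((hasDerivAt_id x).const_mul (4 * κ)).exp
      exact h3.mul h4
    · intro x hx
      obtain ⟨-, h1, h2, h3, -, h4⟩ := hb x hx
      have h5 : e x * w x ≤ κ * N * φ x * |w x| := by
        have : |e x * w x| ≤ K * φ x * |w x| := by
          rw [abs_mul]; exact mul_le_mul_of_nonneg_right h2 (abs_nonneg _)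
        have h6 : K * φ x * |w x| ≤ κ * N * φ x * |w x| := by
          have := mul_nonneg h3.le (abs_nonneg (w x))
          nlinarith
        linarith [le_abs_self (e x * w x)]
      have h6 : a x * w x ^ 2 ≤ -(4 * κ) * w x ^ 2 :=
        mul_le_mul_of_nonneg_right h1 (sq_nonneg _)
      have h7 : N ^ 2 * (φ x * (-φ' x)) ≤ N ^ 2 * (κ * φ x ^ 2) := by
        refine mul_le_mul_of_nonneg_left ?_ (sq_nonneg _)
        nlinarith
      have h8 : 0 ≤ κ * (|w x| - N * φ x) ^ 2 := mul_nonneg hκ.le (sq_nonneg _)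
      have h9 : κ * (|w x| - N * φ x) ^ 2
          = κ * w x ^ 2 - 2 * (κ * N * φ x * |w x|) + κ * (N ^ 2 * φ x ^ 2) := by
        rw [sub_sq, sq_abs]; ring
      have h10 : 0 ≤ κ * w x ^ 2 := by positivity
      have h11 : 0 ≤ κ * (N ^ 2 * φ x ^ 2) := by positivity
      have h12 : 2 * w x * (a x * w x + e x) - N ^ 2 * (2 * φ x * φ' x) + 4 * κ * u x ≤ 0 := by
        simp only [hu]; nlinarith
      have := mul_nonneg (neg_nonneg.2 h12) (Real.exp_pos (4 * κ * x)).le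
      nlinarith
  refine ⟨N, ?_⟩
  filter_upwards [eventually_ge_atTop b] with x hx
  have h1 := hmono self_mem_Ici hx hx
  have hux : u x ≤ 0 := by
    by_contra! hpos
    have h2 := mul_pos hpos (Real.exp_pos (4 * κ * x))
    have h3 := mul_nonpos_of_nonpos_of_nonneg hub (Real.exp_pos (4 * κ * b)).le
    simp only at h1
    linarith
  refine abs_le_of_sq_le_sq ?_ (mul_nonneg hN0 (hb x hx).2.2.2.1.le)
  simp only [hu] at hux
  rw [mul_pow]; linarith

/-- An eventually strictly increasing function that blows up at `T` has an inverse near infinity. -/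
theorem exists_inverse_of_tendsto_atTop {θ θ' : ℝ → ℝ} {T : ℝ}
    (hθ : ∀ᶠ t in 𝓝[<] T, HasDerivAt θ (θ' t) t) (hpos : ∀ᶠ t in 𝓝[<] T, 0 < θ' t)
    (hlim : Tendsto θ (𝓝[<] T) atTop) :
    ∃ s : ℝ → ℝ, Tendsto s atTop (𝓝[<] T) ∧
      (∀ᶠ x in atTop, θ (s x) = x ∧ HasDerivAt s (θ' (s x))⁻¹ x) ∧
      ∀ᶠ t in 𝓝[<] T, s (θ t) = t := by
  obtain ⟨a, haT, ha⟩ := (mem_nhdsLT_iff_exists_Ioo_subset).1 (hθ.and hpos)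
  have haT : a < T := haT
  have hmono : StrictMonoOn θ (Ioo a T) := by
    refine strictMonoOn_of_deriv_pos (convex_Ioo a T)
      (fun t ht => (ha ht).1.continuousAt.continuousWithinAt) ?_
    intro t ht
    rw [interior_Ioo] at ht
    rw [(ha ht).1.deriv]
    exact (ha ht).2
  obtain ⟨b, hab, hbT⟩ := exists_between haT
  -- The implication sits inside the existential so that `choose` gives a total function; its values
  -- below `θ b` are arbitrary.
  have hex : ∀ x, ∃ t, θ b ≤ x → t ∈ Ioo a T ∧ θ t = x := by
    intro x
    by_cases hx : θ b ≤ x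
    · obtain ⟨c, hc, hcb⟩ := ((hlim.eventually_ge_atTop x).and
        (Ioo_mem_nhdsLT hbT)).exists
      have hcont : ContinuousOn θ (Icc b c) := fun t ht =>
        (ha ⟨hab.trans_le ht.1, ht.2.trans_lt hcb.2⟩).1.continuousAt.continuousWithinAt
      obtain ⟨t, ht, rfl⟩ := intermediate_value_Icc hcb.1.le hcont ⟨hx, hc⟩
      exact ⟨t, fun _ => ⟨⟨hab.trans_le ht.1, ht.2.trans_lt hcb.2⟩, rfl⟩⟩
    · exact ⟨0, fun h => absurd h hx⟩
  choose s hs using hex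
  have hlt : ∀ x, θ b ≤ x → ∀ c ∈ Ioo a T, θ c < x → c < s x := by
    intro x hx c hc h
    rw [← (hs x hx).2] at h
    exact (hmono.lt_iff_lt hc (hs x hx).1).1 h
  have hgt : ∀ x, θ b ≤ x → ∀ c ∈ Ioo a T, x < θ c → s x < c := by
    intro x hx c hc h
    rw [← (hs x hx).2] at h
    exact (hmono.lt_iff_lt (hs x hx).1 hc).1 h
  refine ⟨s, ?_, ?_, ?_⟩
  · refine tendsto_nhdsWithin_iff.2 ⟨?_, ?_⟩
    · refine tendsto_order.2 ⟨fun c hc => ?_, fun c hc => ?_⟩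
      · have hc' : max c b ∈ Ioo a T := ⟨hab.trans_le (le_max_right _ _), max_lt hc hbT⟩
        filter_upwards [eventually_ge_atTop (θ b), eventually_gt_atTop (θ (max c b))] with x hx hx'
        exact (le_max_left _ _).trans_lt (hlt x hx _ hc' hx')
      · filter_upwards [eventually_ge_atTop (θ b)] with x hx
        exact (hs x hx).1.2.trans hc
    · filter_upwards [eventually_ge_atTop (θ b)] with x hx
      exact (hs x hx).1.2
  · filter_upwards [eventually_gt_atTop (θ b)] with x hx
    refine ⟨(hs x hx.le).2, ?_⟩
    -- The remaining input is continuity of `s` at `x`, which follows from the order comparisons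
    -- `hlt` and `hgt`.
    refine HasDerivAt.of_local_left_inverse (f := θ) ?_ (ha (hs x hx.le).1).1
      (ha (hs x hx.le).1).2.ne' ?_
    · refine tendsto_order.2 ⟨fun c hc => ?_, fun c hc => ?_⟩
      · obtain ⟨c', h1, h2⟩ := exists_between (max_lt hc (hs x hx.le).1.1)
        have hc' : c' ∈ Ioo a T :=
          ⟨(le_max_right _ _).trans_lt h1, h2.trans (hs x hx.le).1.2⟩
        have h3 : θ c' < x := by
          rw [← (hs x hx.le).2]; exact hmono hc' (hs x hx.le).1 h2
        filter_upwards [lt_mem_nhds hx, lt_mem_nhds h3] with z hz hz'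
        exact ((le_max_left _ _).trans_lt h1).trans (hlt z hz.le c' hc' hz')
      · obtain ⟨c', h1, h2⟩ := exists_between (lt_min hc (hs x hx.le).1.2)
        have hc' : c' ∈ Ioo a T :=
          ⟨(hs x hx.le).1.1.trans h1, h2.trans_le (min_le_right _ _)⟩
        have h3 : x < θ c' := by
          conv_lhs => rw [← (hs x hx.le).2]
          exact hmono (hs x hx.le).1 hc' h1
        filter_upwards [lt_mem_nhds hx, gt_mem_nhds h3] with z hz hz'
        exact (hgt z hz.le c' hc' hz').trans (h2.trans_le (min_le_left _ _))
    · filter_upwards [lt_mem_nhds hx] with z hz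
      exact (hs z hz.le).2
  · filter_upwards [hlim.eventually_ge_atTop (θ b), Ioo_mem_nhdsLT haT] with t ht htm
    exact hmono.injOn (hs _ ht).1 htm (hs _ ht).2

theorem exists_tendsto_of_monotoneOn_Ici {f : ℝ → ℝ} {a B : ℝ} (hf : MonotoneOn f (Ici a))
    (hB : ∀ x, a ≤ x → f x ≤ B) : ∃ L, Tendsto f atTop (𝓝 L) := by
  have hmono : Monotone fun x => f (max x a) := fun x y hxy =>
    hf (mem_Ici.2 (le_max_right x a)) (mem_Ici.2 (le_max_right y a)) (max_le_max_right a hxy)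
  refine ⟨_, (tendsto_atTop_ciSup hmono ⟨B, ?_⟩).congr' ?_⟩
  · rintro _ ⟨x, rfl⟩
    exact hB _ (le_max_right _ _)
  · filter_upwards [eventually_ge_atTop a] with x hx
    rw [max_eq_left hx]

theorem tendsto_atTop_of_deriv_ge {f f' : ℝ → ℝ} {a c : ℝ} (hc : 0 < c)
    (hf : ∀ x, a ≤ x → HasDerivAt f (f' x) x) (hf' : ∀ x, a ≤ x → c ≤ f' x) :
    Tendsto f atTop atTop := by
  have h := monotoneOn_Ici_of_hasDerivAt_nonneg (f := fun x => f x - c * x)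
    (f' := fun x => f' x - c * 1) (a := a)
    (fun x hx => (hf x hx).sub ((hasDerivAt_id x).const_mul c))
    (fun x hx => by linarith [hf' x hx])
  refine tendsto_atTop_mono' atTop (f₁ := fun x => (f a - c * a) + c * x) ?_
    (tendsto_atTop_add_const_left _ _ (tendsto_id.const_mul_atTop hc))
  filter_upwards [eventually_ge_atTop a] with x hx
  have := h self_mem_Ici hx hx
  simp only at this
  linarith

/-! ### Decay rates, and convergence of the direction on the sphere. -/

/-- `φ` is positive, decreases to zero with logarithmic derivative at least `-κ`, and `Φ` is its
tail integral. -/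
structure DecayRate (κ : ℝ) (φ Φ : ℝ → ℝ) : Prop where
  pos : ∀ᶠ x in atTop, 0 < φ x
  slow : ∃ φ' : ℝ → ℝ, ∀ᶠ x in atTop, HasDerivAt φ (φ' x) x ∧ -(κ * φ x) ≤ φ' x ∧ φ' x ≤ 0
  primitive : ∀ᶠ x in atTop, HasDerivAt Φ (-φ x) x
  tendsto : Tendsto φ atTop (𝓝 0)
  tendsto_primitive : Tendsto Φ atTop (𝓝 0)
  primitive_pos : ∀ᶠ x in atTop, 0 < Φ x
  isBigO_primitive : φ =O[atTop] Φ

/-- The quadratic form of the diagonal matrix with entries `d`. -/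
def diagForm {n : ℕ} (d : Fin n → ℝ) (w : EuclideanSpace ℝ (Fin n)) : ℝ := ∑ i, d i * w i ^ 2

section diagForm

variable {n : ℕ} {d : Fin n → ℝ} {w : EuclideanSpace ℝ (Fin n)}

theorem sum_sq_eq_one (hw : ‖w‖ = 1) : ∑ i, w i ^ 2 = 1 := by
  rw [← EuclideanSpace.real_norm_sq_eq, hw, one_pow]

theorem abs_apply_le_one (hw : ‖w‖ = 1) (i : Fin n) : |w i| ≤ 1 := by
  rw [← hw]; exact PiLp.norm_apply_le w i

theorem le_diagForm {m : ℝ} (hd : ∀ i, m ≤ d i) (hw : ‖w‖ = 1) : m ≤ diagForm d w := by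
  calc m = ∑ i, m * w i ^ 2 := by rw [← Finset.mul_sum, sum_sq_eq_one hw, mul_one]
    _ ≤ _ := Finset.sum_le_sum fun i _ => mul_le_mul_of_nonneg_right (hd i) (sq_nonneg _)

theorem diagForm_le {m : ℝ} (hd : ∀ i, d i ≤ m) (hw : ‖w‖ = 1) : diagForm d w ≤ m := by
  calc _ ≤ ∑ i, m * w i ^ 2 :=
        Finset.sum_le_sum fun i _ => mul_le_mul_of_nonneg_right (hd i) (sq_nonneg _)
    _ = m := by rw [← Finset.mul_sum, sum_sq_eq_one hw, mul_one]

theorem diagForm_sub_eq (hw : ‖w‖ = 1) (c : ℝ) :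
    diagForm d w - c = ∑ i, (d i - c) * w i ^ 2 := by
  simp only [diagForm, sub_mul, Finset.sum_sub_distrib]
  rw [← Finset.mul_sum, sum_sq_eq_one hw, mul_one]

end diagForm

/-- The form is a Lyapunov function up to an integrable error, so it converges. Were the limit l
none of the `d i`, the dissipation Σ (d_i - Q)² w_i² would stay bounded below and the form would be
unbounded. -/
theorem exists_tendsto_diagForm {n : ℕ} {d : Fin n → ℝ} {m N : ℝ} (hm : 0 < m)
    (hd : ∀ i, m ≤ d i) (hd' : ∀ i, d i ≤ N) {w : ℝ → EuclideanSpace ℝ (Fin n)}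
    {e : ℝ → Fin n → ℝ} {κ K : ℝ} {φ Φ : ℝ → ℝ} (hφ : DecayRate κ φ Φ)
    (hw : ∀ᶠ x in atTop, ‖w x‖ = 1)
    (hderiv : ∀ᶠ x in atTop, ∀ i,
      HasDerivAt (fun x => w x i) ((d i / diagForm d (w x) - 1) * w x i + e x i) x)
    (he : ∀ᶠ x in atTop, ∀ i, |e x i| ≤ K * φ x) :
    ∃ k, Tendsto (fun x => diagForm d (w x)) atTop (𝓝 (d k)) := by
  have hN : 0 < N := by
    obtain ⟨x, hx⟩ := hw.exists
    exact hm.trans_le ((le_diagForm hd hx).trans (diagForm_le hd' hx))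
  set C : ℝ := ∑ _i : Fin n, N * (2 * K) with hC
  -- Subtracting CΦ adds Cφ to the derivative, which pays for the error terms, each at most 2NKφ in
  -- size.
  set F : ℝ → ℝ := fun x => diagForm d (w x) - C * Φ x with hF
  have hCΦ : Tendsto (fun x => C * Φ x) atTop (𝓝 0) := by
    simpa using hφ.tendsto_primitive.const_mul C
  obtain ⟨a, ha⟩ := eventually_atTop.1 (hw.and (hderiv.and (he.and (hφ.primitive.and
    (hCΦ.eventually (lt_mem_nhds (show (-1 : ℝ) < 0 by norm_num)))))))
  set F' : ℝ → ℝ := fun x =>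
    (∑ i, d i * (2 * w x i * ((d i / diagForm d (w x) - 1) * w x i + e x i))) + C * φ x with hF'
  have hFd : ∀ x, a ≤ x → HasDerivAt F (F' x) x := by
    intro x hx
    obtain ⟨-, h1, -, h2, -⟩ := ha x hx
    have h3 : HasDerivAt (fun x => diagForm d (w x))
        (∑ i, d i * (2 * w x i * ((d i / diagForm d (w x) - 1) * w x i + e x i))) x := by
      refine HasDerivAt.fun_sum fun i _ => ?_
      refine (((h1 i).pow 2).const_mul (d i)).congr_deriv ?_
      simp
    refine (h3.sub (h2.const_mul C)).congr_deriv ?_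
    simp only [hF']; ring
  have hFge : ∀ x, a ≤ x →
      2 / N * ∑ i, (d i - diagForm d (w x)) ^ 2 * w x i ^ 2 ≤ F' x := by
    intro x hx
    obtain ⟨h1, -, h2, -, -⟩ := ha x hx
    set l := diagForm d (w x) with hl
    have hl0 : 0 < l := hm.trans_le (le_diagForm hd h1)
    have hlN : l ≤ N := diagForm_le hd' h1
    have hsum : ∑ i, (d i - l) * w x i ^ 2 = 0 := by
      rw [← diagForm_sub_eq h1, ← hl, sub_self]
    have h3 : 0 ≤ ∑ i, (d i * (2 * w x i * e x i) + N * (2 * K) * φ x) := by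
      refine Finset.sum_nonneg fun i _ => ?_
      have h4 : |d i * (2 * w x i * e x i)| ≤ N * (2 * (1 * (K * φ x))) := by
        rw [abs_mul, mul_assoc, abs_mul 2, abs_mul, abs_two, abs_of_pos (hm.trans_le (hd i))]
        have := h2 i
        have := abs_apply_le_one h1 i
        have := hd' i
        gcongr
      have := neg_abs_le (d i * (2 * w x i * e x i))
      linarith
    have h5 : F' x = 2 / l * ∑ i, (d i - l) ^ 2 * w x i ^ 2
        + ∑ i, (d i * (2 * w x i * e x i) + N * (2 * K) * φ x) := by
      -- Based on d(d/l - 1) = (d - l)²/l + (d - l); the linear part sums to zero because l is the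
      -- weighted mean of the `d i`.
      have h6 : ∑ i, d i * (2 * w x i * ((d i / l - 1) * w x i))
          = 2 / l * ∑ i, (d i - l) ^ 2 * w x i ^ 2 + 2 * ∑ i, (d i - l) * w x i ^ 2 := by
        rw [Finset.mul_sum, Finset.mul_sum, ← Finset.sum_add_distrib]
        refine Finset.sum_congr rfl fun i _ => ?_
        field_simp
        ring
      rw [hsum, mul_zero, add_zero] at h6
      rw [← h6, Finset.sum_add_distrib, ← Finset.sum_mul, ← add_assoc, ← Finset.sum_add_distrib]
      simp only [hF', hC]
      congr 1
      refine Finset.sum_congr rfl fun i _ => ?_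
      ring
    rw [h5]
    have h7 : 0 ≤ ∑ i, (d i - l) ^ 2 * w x i ^ 2 :=
      Finset.sum_nonneg fun i _ => by positivity
    have h8 : 2 / N * ∑ i, (d i - l) ^ 2 * w x i ^ 2
        ≤ 2 / l * ∑ i, (d i - l) ^ 2 * w x i ^ 2 := by gcongr
    linarith
  have hFB : ∀ x, a ≤ x → F x ≤ N + 1 := by
    intro x hx
    obtain ⟨h1, -, -, -, h2⟩ := ha x hx
    have := diagForm_le hd' h1
    simp only [hF]; linarith
  obtain ⟨l, hl⟩ := exists_tendsto_of_monotoneOn_Ici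
    (monotoneOn_Ici_of_hasDerivAt_nonneg hFd fun x hx => le_trans
      (mul_nonneg (by positivity) (Finset.sum_nonneg fun i _ => by positivity)) (hFge x hx)) hFB
  have hlim : Tendsto (fun x => diagForm d (w x)) atTop (𝓝 l) := by
    have := hl.add hCΦ
    simpa [hF] using this
  by_contra! hne
  have hne' : ∀ i, 0 < |d i - l| := fun i => abs_pos.2 fun h => hne i (by
    rw [sub_eq_zero.1 h]; exact hlim)
  -- Half of the distance to the nearest `d i` is kept once the form is within `g` of its limit.
  obtain ⟨g, hg, hgd⟩ : ∃ g > 0, ∀ i, 2 * g ≤ |d i - l| := by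
    rcases isEmpty_or_nonempty (Fin n) with h | h
    · exact ⟨1, one_pos, fun i => h.elim i⟩
    · obtain ⟨j, hj⟩ := Finite.exists_min fun i => |d i - l|
      exact ⟨|d j - l| / 2, half_pos (hne' j), fun i => by linarith [hj i]⟩
  obtain ⟨b, hb⟩ := eventually_atTop.1
    ((Metric.tendsto_nhds.1 hlim g hg).and (eventually_ge_atTop a))
  have htop : Tendsto F atTop atTop := by
    refine tendsto_atTop_of_deriv_ge (a := b) (c := 2 / N * g ^ 2) (by positivity)
      (fun x hx => hFd x (hb x hx).2) fun x hx => ?_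
    refine le_trans ?_ (hFge x (hb x hx).2)
    refine mul_le_mul_of_nonneg_left ?_ (by positivity)
    have h1 := (ha x (hb x hx).2).1
    calc g ^ 2 = ∑ i, g ^ 2 * w x i ^ 2 := by rw [← Finset.mul_sum, sum_sq_eq_one h1, mul_one]
      _ ≤ _ := Finset.sum_le_sum fun i _ => mul_le_mul_of_nonneg_right ?_ (sq_nonneg _)
    have h2 : |diagForm d (w x) - l| < g := (hb x hx).1
    have h3 : g ≤ |d i - diagForm d (w x)| := by
      have := abs_sub_le (d i) (diagForm d (w x)) l
      linarith [hgd i]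
    rw [← sq_abs (d i - _)]
    exact pow_le_pow_left₀ hg.le h3 2
  exact not_tendsto_atTop_of_tendsto_nhds hl htop

/-- A curve on the sphere driven by the projected diagonal flow, up to an error `O(φ)`, converges
to an eigenvector with the rate given by the tail integral of `φ`. -/
theorem exists_isBigO_sub_eigenvector {n : ℕ} {d : Fin n → ℝ} {m N : ℝ} (hm : 0 < m)
    (hd : ∀ i, m ≤ d i) (hd' : ∀ i, d i ≤ N) {w : ℝ → EuclideanSpace ℝ (Fin n)}
    {e : ℝ → Fin n → ℝ} {κ K : ℝ} {φ Φ : ℝ → ℝ} (hφ : DecayRate κ φ Φ) (hκ : 0 < κ)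
    (hgap : ∀ i j, d i ≠ d j → 8 * κ ≤ |d i / d j - 1|)
    (hw : ∀ᶠ x in atTop, ‖w x‖ = 1)
    (hderiv : ∀ᶠ x in atTop, ∀ i,
      HasDerivAt (fun x => w x i) ((d i / diagForm d (w x) - 1) * w x i + e x i) x)
    (he : ∀ᶠ x in atTop, ∀ i, |e x i| ≤ K * φ x) :
    ∃ k L, ‖L‖ = 1 ∧ (∀ i, d i ≠ d k → L i = 0) ∧ (fun x => w x - L) =O[atTop] Φ := by
  obtain ⟨k, hk⟩ := exists_tendsto_diagForm hm hd hd' hφ hw hderiv he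
  obtain ⟨φ', hφ'⟩ := hφ.slow
  have hKφ : ∀ᶠ x in atTop, ∀ i, |e x i| ≤ |K| * φ x := by
    filter_upwards [he, hφ.pos] with x hx hp i
    exact (hx i).trans (mul_le_mul_of_nonneg_right (le_abs_self K) hp.le)
  have hcoef : ∀ i, Tendsto (fun x => d i / diagForm d (w x) - 1) atTop (𝓝 (d i / d k - 1)) :=
    fun i => (tendsto_const_nhds.div hk (hm.trans_le (hd k)).ne').sub_const 1
  -- The sign of d_i/d_k - 1 decides between instability, where |w_i| ≤ 1 supplies boundedness, and
  -- stability. The gap 8κ leaves a coefficient beyond 4κ after passing to the limit.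
  have hstab : ∀ i, d i ≠ d k → ∃ M, ∀ᶠ x in atTop, |w x i| ≤ M * φ x := by
    intro i hi
    have hd1 := hderiv.mono fun x hx => hx i
    have he1 := hKφ.mono fun x hx => hx i
    rcases le_abs.1 (hgap i k hi) with h | h
    · refine ⟨|K| / κ, abs_le_of_unstable (B := 1) hκ (abs_nonneg K) hd1 ?_ he1
        (hw.mono fun x hx => abs_apply_le_one hx i) hφ.pos (hφ'.mono fun x hx => hx.1)
        (hφ'.mono fun x hx => hx.2.2)⟩
      exact ((hcoef i).eventually (lt_mem_nhds (show κ < _ by linarith))).mono fun x hx => hx.le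
    · refine exists_abs_le_of_stable hκ hd1 ?_ he1 hφ.pos (hφ'.mono fun x hx => hx.1)
        (hφ'.mono fun x hx => hx.2.1)
      exact ((hcoef i).eventually (gt_mem_nhds (show _ < -(4 * κ) by linarith))).mono
        fun x hx => hx.le
  have hbig : ∀ i, d i ≠ d k → (fun x => w x i) =O[atTop] φ := by
    intro i hi
    obtain ⟨M, hM⟩ := hstab i hi
    refine IsBigO.of_bound M ?_
    filter_upwards [hM, hφ.pos] with x hx hp
    rwa [Real.norm_eq_abs, Real.norm_of_nonneg hp.le]
  -- In Σ (d_i - d_k) w_i² only the coordinates already known to be O(φ) survive.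
  have hform : (fun x => diagForm d (w x) - d k) =O[atTop] φ := by
    have h1 : (fun x => ∑ i, (d i - d k) * w x i ^ 2) =O[atTop] φ := by
      refine IsBigO.fun_sum fun i _ => ?_
      by_cases hi : d i = d k
      · simp only [hi, sub_self, zero_mul]; exact isBigO_zero _ _
      · refine IsBigO.trans (IsBigO.of_bound |d i - d k| ?_) (hbig i hi)
        filter_upwards [hw] with x hx
        have := abs_apply_le_one hx i
        rw [norm_mul, norm_pow, Real.norm_eq_abs, Real.norm_eq_abs]
        refine mul_le_mul_of_nonneg_left ?_ (abs_nonneg _)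
        nlinarith [abs_nonneg (w x i)]
    refine h1.congr' ?_ EventuallyEq.rfl
    filter_upwards [hw] with x hx
    rw [diagForm_sub_eq hx]
  -- Every coordinate now has an integrable derivative: when d_i = d_k the coefficient itself is
  -- O(φ) by `hform`, otherwise w_i is.
  have hdO : ∀ i, (fun x => (d i / diagForm d (w x) - 1) * w x i + e x i) =O[atTop] φ := by
    intro i
    have hwO : (fun x => w x i) =O[atTop] fun _ => (1 : ℝ) := by
      refine IsBigO.of_bound 1 ?_
      filter_upwards [hw] with x hx
      simpa using abs_apply_le_one hx i
    have heO : (fun x => e x i) =O[atTop] φ := by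
      refine IsBigO.of_bound |K| ?_
      filter_upwards [hKφ, hφ.pos] with x hx hp
      rw [Real.norm_eq_abs, Real.norm_of_nonneg hp.le]; exact hx i
    refine IsBigO.add ?_ heO
    by_cases hi : d i = d k
    · have h1 : (fun x => -(diagForm d (w x))⁻¹ * (diagForm d (w x) - d k) * w x i)
          =O[atTop] fun x => 1 * φ x * 1 :=
        (((hk.inv₀ (hm.trans_le (hd k)).ne').neg.isBigO_one ℝ).mul hform).mul hwO
      refine (h1.congr' ?_ ?_)
      · filter_upwards [hw] with x hx
        have := hm.trans_le (le_diagForm hd hx)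
        rw [hi]; field_simp; ring
      · exact Eventually.of_forall fun x => by simp
    · simpa using ((hcoef i).isBigO_one ℝ).mul (hbig i hi)
  have hlimi : ∀ i, ∃ l, Tendsto (fun x => w x i) atTop (𝓝 l) ∧
      (fun x => w x i - l) =O[atTop] Φ := by
    intro i
    obtain ⟨c, hc, hcb⟩ := (hdO i).exists_pos
    obtain ⟨l, hl, hl'⟩ := exists_tendsto_of_norm_deriv_le (Φ := fun x => c * Φ x)
      (Φ' := fun x => c * -φ x) (hderiv.mono fun x hx => hx i)
      (hφ.primitive.mono fun x hx => hx.const_mul c) (by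
        filter_upwards [hcb.bound, hφ.pos] with x hx hp
        rw [Real.norm_of_nonneg hp.le] at hx
        linarith) (by simpa using hφ.tendsto_primitive.const_mul c)
    refine ⟨l, hl, IsBigO.of_bound c ?_⟩
    filter_upwards [hl'] with x hx
    exact hx.trans (mul_le_mul_of_nonneg_left (le_abs_self _) hc.le)
  choose l hl hlO using hlimi
  have htend : Tendsto w atTop (𝓝 (WithLp.toLp 2 l)) := by
    have := (PiLp.continuous_toLp 2 (fun _ : Fin n => ℝ)).continuousAt.tendsto.comp
      (tendsto_pi_nhds.2 hl)
    exact this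
  refine ⟨k, WithLp.toLp 2 l, ?_, ?_, ?_⟩
  · exact tendsto_nhds_unique htend.norm (tendsto_const_nhds.congr' (hw.mono fun x hx => hx.symm))
  · intro i hi
    exact tendsto_nhds_unique (hl i) ((hbig i hi).trans_tendsto hφ.tendsto)
  · have h1 : (fun x => ∑ i, |w x i - l i|) =O[atTop] Φ :=
      IsBigO.fun_sum fun i _ => (hlO i).abs_left
    refine IsBigO.trans (IsBigO.of_bound 1 (Eventually.of_forall fun x => ?_)) h1
    rw [one_mul, Real.norm_of_nonneg (Finset.sum_nonneg fun i _ => abs_nonneg _)]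
    have h2 : ‖w x - WithLp.toLp 2 l‖ ^ 2 ≤ (∑ i, |w x i - l i|) ^ 2 := by
      rw [EuclideanSpace.real_norm_sq_eq]
      have := Finset.sum_sq_le_sq_sum_of_nonneg (s := Finset.univ)
        (f := fun i => |w x i - l i|) fun i _ => abs_nonneg _
      simpa using this
    exact le_of_sq_le_sq h2 (Finset.sum_nonneg fun i _ => abs_nonneg _)

/-! ### Polar coordinates for the perturbed diagonal flow. -/

section NormalizedFlow

variable {n : ℕ} {d : Fin n → ℝ}

theorem abs_inner_le_of_norm_eq_one {w q : EuclideanSpace ℝ (Fin n)} (hw : ‖w‖ = 1) :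
    |inner ℝ w q| ≤ ‖q‖ := by
  simpa [hw] using abs_real_inner_le_norm w q

/-- The polar decomposition of a perturbed diagonal flow. -/
theorem hasDerivAt_log_norm {z : ℝ → EuclideanSpace ℝ (Fin n)}
    {z' q : EuclideanSpace ℝ (Fin n)} {h t : ℝ} (hz : HasDerivAt z z' t) (h0 : z t ≠ 0)
    (hz' : ∀ i, z' i = h * (d i * z t i + ‖z t‖ * q i)) :
    HasDerivAt (fun t => Real.log ‖z t‖)
      (h * (diagForm d (‖z t‖⁻¹ • z t) + inner ℝ (‖z t‖⁻¹ • z t) q)) t := by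
  have hn : 0 < ‖z t‖ := norm_pos_iff.2 h0
  have h1 : HasDerivAt (fun t => Real.log (‖z t‖ ^ 2) / 2)
      (2 * inner ℝ (z t) z' / ‖z t‖ ^ 2 / 2) t := (hz.norm_sq.log (by positivity)).div_const 2
  have h2 : (fun t => Real.log (‖z t‖ ^ 2) / 2) = fun t => Real.log ‖z t‖ := by
    funext t; rw [Real.log_pow]; push_cast; ring
  rw [h2] at h1
  refine h1.congr_deriv ?_
  have h3 : inner ℝ (z t) z' = ∑ i, h * (d i * z t i ^ 2 + ‖z t‖ * (z t i * q i)) := by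
    rw [PiLp.inner_apply]
    refine Finset.sum_congr rfl fun i _ => ?_
    rw [hz' i]; simp; ring
  have h4 : inner ℝ (z t) q = ∑ i, z t i * q i := by
    rw [PiLp.inner_apply]
    refine Finset.sum_congr rfl fun i _ => ?_
    simp; ring
  have h5 : diagForm d (‖z t‖⁻¹ • z t) = ‖z t‖⁻¹ ^ 2 * ∑ i, d i * z t i ^ 2 := by
    rw [diagForm, Finset.mul_sum]
    refine Finset.sum_congr rfl fun i _ => ?_
    simp; ring
  rw [h3, h5, real_inner_smul_left, h4, ← Finset.mul_sum, Finset.sum_add_distrib,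
    ← Finset.mul_sum]
  field_simp

/-- Near `t` the direction equals exp(-log |z|) z, so the derivative `r` of the clock enters through
the product rule. -/
theorem hasDerivAt_normalize_apply {z : ℝ → EuclideanSpace ℝ (Fin n)}
    {z' q : EuclideanSpace ℝ (Fin n)} {h t r : ℝ} (hz : HasDerivAt z z' t) (h0 : z t ≠ 0)
    (hz' : ∀ i, z' i = h * (d i * z t i + ‖z t‖ * q i))
    (hr : HasDerivAt (fun t => Real.log ‖z t‖) r t) (hne : ∀ᶠ u in 𝓝 t, z u ≠ 0) (i : Fin n) :
    HasDerivAt (fun t => (‖z t‖⁻¹ • z t) i)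
      (h * (d i * (‖z t‖⁻¹ • z t) i + q i) - (‖z t‖⁻¹ • z t) i * r) t := by
  have hn : 0 < ‖z t‖ := norm_pos_iff.2 h0
  have h1 : HasDerivAt (fun t => z t i) (z' i) t := by
    have := (EuclideanSpace.proj i : EuclideanSpace ℝ (Fin n) →L[ℝ] ℝ).hasFDerivAt.comp_hasDerivAt
      t hz
    exact this
  have h2 := (hr.fun_neg.exp).mul h1
  have h3 : Real.exp (-Real.log ‖z t‖) = ‖z t‖⁻¹ := by
    rw [Real.exp_neg, Real.exp_log hn]
  rw [h3] at h2
  refine (h2.congr_deriv ?_).congr_of_eventuallyEq ?_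
  · rw [hz' i]; simp; field_simp; ring
  · filter_upwards [hne] with u hu
    simp [Real.exp_neg, Real.exp_log (norm_pos_iff.2 hu)]

/-- Linearization in the forcing of the normalized flow. -/
theorem abs_quotient_sub_le {m N : ℝ} (hm : 0 < m)
    (hd : ∀ i, m ≤ d i) (hd' : ∀ i, d i ≤ N) {w q : EuclideanSpace ℝ (Fin n)}
    (hw : ‖w‖ = 1) (hq : ‖q‖ ≤ m / 2) (i : Fin n) :
    |(d i * w i + q i) / (diagForm d w + inner ℝ w q) - d i / diagForm d w * w i|
      ≤ 4 * N / m ^ 2 * ‖q‖ := by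
  have h1 := le_diagForm hd hw
  have h2 := diagForm_le hd' hw
  have h3 := abs_inner_le_of_norm_eq_one (q := q) hw
  have h4 : m / 2 ≤ diagForm d w + inner ℝ w q := by
    linarith [neg_abs_le (inner ℝ w q)]
  set l := diagForm d w
  set p := inner ℝ w q
  have hl : 0 < l := by linarith
  have hlp : 0 < l + p := by linarith
  have h5 : (d i * w i + q i) / (l + p) - d i / l * w i
      = (l * q i - d i * w i * p) / (l * (l + p)) := by
    field_simp; ring
  have h6 : |l * q i - d i * w i * p| ≤ N * ‖q‖ + N * 1 * ‖q‖ := by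
    refine (abs_sub _ _).trans ?_
    rw [abs_mul, abs_mul, abs_mul, abs_of_pos hl, abs_of_pos (hm.trans_le (hd i))]
    have h7 : |q i| ≤ ‖q‖ := PiLp.norm_apply_le q i
    have h8 := abs_apply_le_one hw i
    have h9 := hd' i
    have h10 : 0 ≤ N := by linarith
    gcongr
  rw [h5, abs_div, abs_of_pos (mul_pos hl hlp), div_le_iff₀ (mul_pos hl hlp)]
  refine h6.trans ?_
  -- The numerator is at most 2N|q| and the denominator at least m²/2, whence the constant 4N/m².
  have h7 : m * (m / 2) ≤ l * (l + p) := by gcongr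
  calc N * ‖q‖ + N * 1 * ‖q‖ = 4 * N / m ^ 2 * ‖q‖ * (m * (m / 2)) := by field_simp; ring
    _ ≤ _ := by
      have : 0 ≤ N := by linarith
      gcongr

end NormalizedFlow

/-! ### Positivity, lower bounds and Hölder estimates for the homogeneous rate function. -/

section RateFunction

variable {n : ℕ} {α : ℝ} {H : EuclideanSpace ℝ (Fin n) → ℝ}

theorem IsRateFunction.apply_eq (hH : IsRateFunction α H) {x : EuclideanSpace ℝ (Fin n)}
    (hx : x ≠ 0) : H x = ‖x‖ ^ α * H (‖x‖⁻¹ • x) := by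
  have hn : 0 < ‖x‖ := norm_pos_iff.2 hx
  have := hH.homogeneous (‖x‖⁻¹ • x) (smul_ne_zero (inv_ne_zero hn.ne') hx) ‖x‖ hn
  rwa [smul_smul, mul_inv_cancel₀ hn.ne', one_smul, smul_eq_mul] at this

theorem norm_inv_smul_mem_sphere {x : EuclideanSpace ℝ (Fin n)} (hx : x ≠ 0) :
    ‖x‖⁻¹ • x ∈ Metric.sphere (0 : EuclideanSpace ℝ (Fin n)) 1 := by
  rw [mem_sphere_zero_iff_norm, norm_smul, norm_inv, norm_norm,
    inv_mul_cancel₀ (norm_ne_zero_iff.2 hx)]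

theorem IsRateFunction.pos (hH : IsRateFunction α H) {x : EuclideanSpace ℝ (Fin n)}
    (hx : x ≠ 0) : 0 < H x := by
  rw [hH.apply_eq hx]
  exact mul_pos (Real.rpow_pos_of_pos (norm_pos_iff.2 hx) _)
    (hH.pos_sphere _ (norm_inv_smul_mem_sphere hx))

theorem IsRateFunction.exists_le (hH : IsRateFunction α H) :
    ∃ c > 0, ∀ x, x ≠ 0 → c * ‖x‖ ^ α ≤ H x := by
  obtain ⟨c, hc, hcH⟩ : ∃ c > 0,
      ∀ x ∈ Metric.sphere (0 : EuclideanSpace ℝ (Fin n)) 1, c ≤ H x := by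
    -- The sphere is empty when `n = 0`.
    rcases (Metric.sphere (0 : EuclideanSpace ℝ (Fin n)) 1).eq_empty_or_nonempty with h | h
    · exact ⟨1, one_pos, fun x hx => by simp [h] at hx⟩
    · obtain ⟨x, hx, hmin⟩ := (isCompact_sphere (0 : EuclideanSpace ℝ (Fin n)) 1).exists_isMinOn h
        hH.continuousOn_sphere
      exact ⟨H x, hH.pos_sphere x hx, fun z hz => hmin hz⟩
  refine ⟨c, hc, fun x hx => ?_⟩
  rw [hH.apply_eq hx, mul_comm]
  exact mul_le_mul_of_nonneg_left (hcH _ (norm_inv_smul_mem_sphere hx)) (by positivity)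

/-- With an exponent at most 1, Φ = O(Φ^γ) as Φ → 0, so the Hölder error absorbs the errors of order
Φ. -/
theorem HolderAtOn.min_one {F : EuclideanSpace ℝ (Fin n) → ℝ}
    {E : Set (EuclideanSpace ℝ (Fin n))} {x₀ : EuclideanSpace ℝ (Fin n)} {γ : ℝ} (hγ : 0 < γ)
    (h : HolderAtOn F E x₀ γ) : HolderAtOn F E x₀ (min γ 1) := by
  obtain ⟨r, C, hr, hC, h⟩ := h
  refine ⟨min r 1, C, lt_min hr one_pos, hC, fun x hx hxr => ?_⟩
  refine (h x hx (hxr.trans_le (min_le_left _ _))).trans ?_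
  exact mul_le_mul_of_nonneg_left (Real.rpow_le_rpow_of_exponent_ge' (norm_nonneg _)
    (hxr.le.trans (min_le_right _ _)) (by positivity) (min_le_left _ _)) hC.le

theorem norm_normalize_sub_le {x x₀ : EuclideanSpace ℝ (Fin n)} (h₀ : x₀ ≠ 0) :
    ‖‖x‖⁻¹ • x - ‖x₀‖⁻¹ • x₀‖ ≤ 2 * ‖x₀‖⁻¹ * ‖x - x₀‖ := by
  have hn₀ : 0 < ‖x₀‖ := norm_pos_iff.2 h₀
  rcases eq_or_ne x 0 with rfl | hx
  · simp [norm_smul, hn₀.ne']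
  have hn : 0 < ‖x‖ := norm_pos_iff.2 hx
  have h1 : ‖x‖⁻¹ • x - ‖x₀‖⁻¹ • x₀
      = ‖x₀‖⁻¹ • (x - x₀) + (‖x₀‖⁻¹ * (‖x₀‖ - ‖x‖)) • (‖x‖⁻¹ • x) := by
    rw [smul_smul, smul_sub, sub_add_eq_add_sub, ← add_smul]
    congr 2
    field_simp; ring
  have h2 : ‖‖x‖⁻¹ • x‖ = 1 := by simp [norm_smul, hn.ne']
  rw [h1]
  refine (norm_add_le _ _).trans ?_
  rw [norm_smul, norm_smul, h2, norm_mul, norm_inv, norm_norm, Real.norm_eq_abs]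
  have h3 : |‖x₀‖ - ‖x‖| ≤ ‖x - x₀‖ := by
    rw [norm_sub_rev]; exact abs_norm_sub_norm_le _ _
  have : ‖x₀‖⁻¹ * |‖x₀‖ - ‖x‖| ≤ ‖x₀‖⁻¹ * ‖x - x₀‖ := by gcongr
  linarith

/-- A homogeneous function that is Hölder continuous at a direction is so along curves that
converge to a vector of this direction. -/
theorem IsRateFunction.isBigO_sub (hH : IsRateFunction α H)
    {x : ℝ → EuclideanSpace ℝ (Fin n)} {x₀ : EuclideanSpace ℝ (Fin n)} (h₀ : x₀ ≠ 0)
    {γ : ℝ} (hγ : 0 < γ) (hγ1 : γ ≤ 1) (hHol : HolderAtOn H (Metric.sphere 0 1) (‖x₀‖⁻¹ • x₀) γ)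
    {Φ : ℝ → ℝ} (hΦ : Tendsto Φ atTop (𝓝 0)) (hΦ0 : ∀ᶠ t in atTop, 0 < Φ t)
    (hx : (fun t => x t - x₀) =O[atTop] Φ) :
    (fun t => H (x t) - H x₀) =O[atTop] fun t => Φ t ^ γ := by
  obtain ⟨r, C, hr, hC, hHol⟩ := hHol
  have hn₀ : 0 < ‖x₀‖ := norm_pos_iff.2 h₀
  have hsub : Tendsto (fun t => x t - x₀) atTop (𝓝 0) := hx.trans_tendsto hΦ
  have hlim : Tendsto x atTop (𝓝 x₀) := by simpa using hsub.add_const x₀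
  have hne : ∀ᶠ t in atTop, x t ≠ 0 := hlim.eventually_ne h₀
  have hΦγ : Φ =O[atTop] fun t => Φ t ^ γ := by
    refine IsBigO.of_bound 1 ?_
    filter_upwards [hΦ0, hΦ.eventually (gt_mem_nhds one_pos)] with t h1 h2
    rw [one_mul, Real.norm_of_nonneg h1.le, Real.norm_of_nonneg (by positivity)]
    simpa using Real.rpow_le_rpow_of_exponent_ge h1 h2.le hγ1
  have hdir : (fun t => ‖x t‖⁻¹ • x t - ‖x₀‖⁻¹ • x₀) =O[atTop] Φ :=
    IsBigO.trans (IsBigO.of_bound (2 * ‖x₀‖⁻¹)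
      (Eventually.of_forall fun t => norm_normalize_sub_le h₀)) hx
  have h1 : (fun t => H (‖x t‖⁻¹ • x t) - H (‖x₀‖⁻¹ • x₀)) =O[atTop] fun t => Φ t ^ γ := by
    obtain ⟨K, hK, hKb⟩ := hdir.exists_pos
    refine IsBigO.of_bound (C * K ^ γ) ?_
    filter_upwards [hKb.bound, hΦ0, hne, ((hdir.trans_tendsto hΦ).norm.eventually
      (gt_mem_nhds (show ‖(0 : EuclideanSpace ℝ (Fin n))‖ < r by simpa using hr)))]
      with t ht hp h0 hlt
    rw [Real.norm_of_nonneg hp.le] at ht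
    rw [Real.norm_eq_abs, Real.norm_of_nonneg (by positivity), mul_assoc,
      ← Real.mul_rpow hK.le hp.le]
    refine (hHol _ (norm_inv_smul_mem_sphere h0) hlt).trans ?_
    exact mul_le_mul_of_nonneg_left (Real.rpow_le_rpow (norm_nonneg _) ht hγ.le) hC.le
  have h2 : (fun t => ‖x t‖ ^ α - ‖x₀‖ ^ α) =O[atTop] Φ := by
    have h3 := (Real.hasDerivAt_rpow_const (p := α) (Or.inl hn₀.ne')).isBigO_sub
    have h4 := h3.comp_tendsto hlim.norm
    refine IsBigO.trans h4 (IsBigO.trans (IsBigO.of_bound 1 (Eventually.of_forall fun t => ?_)) hx)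
    rw [one_mul]; exact abs_norm_sub_norm_le _ _
  have h3 : Tendsto (fun t => ‖x t‖ ^ α) atTop (𝓝 (‖x₀‖ ^ α)) :=
    hlim.norm.rpow_const (Or.inl hn₀.ne')
  -- Homogeneity splits the difference into an angular part, which is Hölder, and a radial part,
  -- which is differentiable at |x₀| > 0.
  have h4 : (fun t => ‖x t‖ ^ α * (H (‖x t‖⁻¹ • x t) - H (‖x₀‖⁻¹ • x₀))
      + (‖x t‖ ^ α - ‖x₀‖ ^ α) * H (‖x₀‖⁻¹ • x₀)) =O[atTop] fun t => Φ t ^ γ := by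
    refine IsBigO.add ?_ ?_
    · simpa using (h3.isBigO_one ℝ).mul h1
    · simpa [mul_comm] using (h2.trans hΦγ).const_mul_left (H (‖x₀‖⁻¹ • x₀))
  refine h4.congr' ?_ EventuallyEq.rfl
  filter_upwards [hne] with t ht
  rw [hH.apply_eq ht, hH.apply_eq h₀]; ring

end RateFunction

/-! ### From the logarithmic clock back to time: remaining time and blow-up profile. -/

/-- Integration of a time change with exponentially decaying speed. -/
theorem isBigO_remaining_time {α c γ T κ : ℝ} (hα : 0 < α) (hγ : 0 < γ) {s g φ Φ : ℝ → ℝ}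
    (hφ : DecayRate κ φ Φ) (hs : ∀ᶠ x in atTop, HasDerivAt s (Real.exp (-α * x) * g x) x)
    (hg : (fun x => g x - c) =O[atTop] fun x => Φ x ^ γ) (hlim : Tendsto s atTop (𝓝 T)) :
    (fun x => (T - s x) * Real.exp (α * x) - c / α) =O[atTop] fun x => Φ x ^ γ := by
  obtain ⟨K, hK, hKb⟩ := hg.exists_pos
  have hexp : ∀ x : ℝ, HasDerivAt (fun x => Real.exp (-α * x)) (Real.exp (-α * x) * (-α)) x := by
    intro x
    simpa using ((hasDerivAt_id x).const_mul (-α)).exp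
  have hexp0 : Tendsto (fun x : ℝ => Real.exp (-α * x)) atTop (𝓝 0) :=
    Real.tendsto_exp_atBot.comp (tendsto_id.const_mul_atTop_of_neg (by linarith))
  have hΦγ : Tendsto (fun x => Φ x ^ γ) atTop (𝓝 0) := by
    have := hφ.tendsto_primitive.rpow_const (p := γ) (Or.inr hγ.le)
    rwa [Real.zero_rpow hγ.ne'] at this
  have h1 : ∀ᶠ x in atTop, HasDerivAt (fun x => s x + c / α * Real.exp (-α * x))
      (Real.exp (-α * x) * (g x - c)) x := by
    filter_upwards [hs] with x hx
    refine (hx.add ((hexp x).const_mul (c / α))).congr_deriv ?_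
    field_simp; ring
  -- This majorant needs no explicit integration: since Φ^γ decreases, minus its derivative is at
  -- least K e^(-αx) Φ^γ.
  have h2 : ∀ᶠ x in atTop, HasDerivAt (fun x => K / α * (Real.exp (-α * x) * Φ x ^ γ))
      (K / α * (Real.exp (-α * x) * (-α) * Φ x ^ γ
        + Real.exp (-α * x) * (-φ x * γ * Φ x ^ (γ - 1)))) x := by
    filter_upwards [hφ.primitive, hφ.primitive_pos] with x hx hp
    exact ((hexp x).mul (hx.rpow_const (Or.inl hp.ne'))).const_mul (K / α)
  have h3 : ∀ᶠ x in atTop, ‖Real.exp (-α * x) * (g x - c)‖ ≤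
      -(K / α * (Real.exp (-α * x) * (-α) * Φ x ^ γ
        + Real.exp (-α * x) * (-φ x * γ * Φ x ^ (γ - 1)))) := by
    filter_upwards [hKb.bound, hφ.primitive_pos, hφ.pos] with x hx hp hp'
    rw [Real.norm_of_nonneg (Real.rpow_nonneg hp.le γ)] at hx
    rw [norm_mul, Real.norm_of_nonneg (Real.exp_pos _).le]
    have h1 := mul_le_mul_of_nonneg_left hx (Real.exp_pos (-α * x)).le
    have h2 : 0 ≤ K / α * (Real.exp (-α * x) * (φ x * γ * Φ x ^ (γ - 1))) := by positivity
    have h3 : -(K / α * (Real.exp (-α * x) * (-α) * Φ x ^ γ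
        + Real.exp (-α * x) * (-φ x * γ * Φ x ^ (γ - 1))))
        = Real.exp (-α * x) * (K * Φ x ^ γ)
          + K / α * (Real.exp (-α * x) * (φ x * γ * Φ x ^ (γ - 1))) := by
      field_simp; ring
    rw [h3]; linarith
  obtain ⟨L, hL, hLb⟩ := exists_tendsto_of_norm_deriv_le h1 h2 h3
    (by simpa using (hexp0.mul hΦγ).const_mul (K / α))
  have hLT : L = T := tendsto_nhds_unique hL (by simpa using hlim.add (hexp0.const_mul (c / α)))
  subst hLT
  refine IsBigO.of_bound (K / α) ?_
  filter_upwards [hLb, hφ.primitive_pos] with x hx hp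
  have h1 : (L - s x) * Real.exp (α * x) - c / α
      = -(s x + c / α * Real.exp (-α * x) - L) * Real.exp (α * x) := by
    have : Real.exp (-α * x) * Real.exp (α * x) = 1 := by
      rw [← Real.exp_add]; simp
    linear_combination (c / α) * this
  rw [h1, norm_mul, norm_neg, Real.norm_of_nonneg (Real.exp_pos _).le,
    Real.norm_of_nonneg (Real.rpow_nonneg hp.le γ)]
  refine (mul_le_mul_of_nonneg_right hx (Real.exp_pos (α * x)).le).trans (le_of_eq ?_)
  have : Real.exp (-α * x) * Real.exp (α * x) = 1 := by
    rw [← Real.exp_add]; simp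
  linear_combination (K / α * Φ x ^ γ) * this

/-- Convergence of the direction and the remaining time of a blow-up solution, in terms of the
logarithmic clock. -/
theorem exists_isBigO_normalized_flow {n : ℕ} {d : Fin n → ℝ} {m N α κ K T : ℝ}
    {H : EuclideanSpace ℝ (Fin n) → ℝ}
    (hm : 0 < m) (hd : ∀ i, m ≤ d i) (hd' : ∀ i, d i ≤ N) (hα : 0 < α)
    (hH : IsRateFunction α H) (hHC : PropertyHC H (Metric.sphere 0 1)) {φ Φ : ℝ → ℝ}
    (hφ : DecayRate κ φ Φ) (hκ : 0 < κ)
    (hgap : ∀ i j, d i ≠ d j → 8 * κ ≤ |d i / d j - 1|)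
    (B : EuclideanSpace ℝ (Fin n) ≃L[ℝ] EuclideanSpace ℝ (Fin n))
    {w q : ℝ → EuclideanSpace ℝ (Fin n)} {s : ℝ → ℝ} (hw : ∀ᶠ x in atTop, ‖w x‖ = 1)
    (hq : ∀ᶠ x in atTop, ‖q x‖ ≤ K * φ x)
    (hwd : ∀ᶠ x in atTop, ∀ i, HasDerivAt (fun x => w x i)
      ((d i * w x i + q x i) / (diagForm d (w x) + inner ℝ (w x) (q x)) - w x i) x)
    (hs : ∀ᶠ x in atTop, HasDerivAt s (Real.exp (-α * x) *
      (H (B.symm (w x)) * (diagForm d (w x) + inner ℝ (w x) (q x)))⁻¹) x)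
    (hsT : Tendsto s atTop (𝓝 T)) :
    ∃ k L, ‖L‖ = 1 ∧ (∀ i, d i ≠ d k → L i = 0) ∧ ∃ γ : ℝ, 0 < γ ∧
      (fun x => w x - L) =O[atTop] (fun x => Φ x ^ γ) ∧
      (fun x => (T - s x) * Real.exp (α * x) - (H (B.symm L) * d k)⁻¹ / α)
        =O[atTop] fun x => Φ x ^ γ := by
  have hq0 : Tendsto q atTop (𝓝 0) :=
    squeeze_zero_norm' hq (by simpa using hφ.tendsto.const_mul K)
  have hqm : ∀ᶠ x in atTop, ‖q x‖ ≤ m / 2 :=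
    (hq0.norm.eventually (gt_mem_nhds (show ‖(0 : EuclideanSpace ℝ (Fin n))‖ < m / 2 by
      simpa using hm))).mono fun x hx => hx.le
  obtain ⟨k, L, hL, hLk, hLO⟩ := exists_isBigO_sub_eigenvector hm hd hd' (w := w)
    (e := fun x i => (d i * w x i + q x i) / (diagForm d (w x) + inner ℝ (w x) (q x))
      - d i / diagForm d (w x) * w x i) (K := 4 * N / m ^ 2 * K) hφ hκ hgap hw (by
      filter_upwards [hwd] with x hx i
      refine (hx i).congr_deriv ?_
      ring) (by
      filter_upwards [hw, hq, hqm] with x h1 h2 h3 i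
      refine (abs_quotient_sub_le hm hd hd' h1 h3 i).trans ?_
      have : 0 ≤ N := hm.le.trans ((le_diagForm hd h1).trans (diagForm_le hd' h1))
      rw [mul_assoc]
      gcongr)
  have hL0 : L ≠ 0 := by rintro rfl; simp at hL
  have hBL : B.symm L ≠ 0 := by simpa using hL0
  obtain ⟨γ₁, hγ₁, hHol⟩ := hHC _ (norm_inv_smul_mem_sphere hBL)
  set γ := min γ₁ 1 with hγdef
  have hγ : 0 < γ := lt_min hγ₁ one_pos
  have hγ1 : γ ≤ 1 := min_le_right _ _
  have hΦγ : Φ =O[atTop] fun x => Φ x ^ γ := by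
    refine IsBigO.of_bound 1 ?_
    filter_upwards [hφ.primitive_pos, hφ.tendsto_primitive.eventually (gt_mem_nhds one_pos)]
      with x h1 h2
    rw [one_mul, Real.norm_of_nonneg h1.le, Real.norm_of_nonneg (by positivity)]
    simpa using Real.rpow_le_rpow_of_exponent_ge h1 h2.le hγ1
  refine ⟨k, L, hL, hLk, γ, hγ, hLO.trans hΦγ, isBigO_remaining_time hα hγ hφ hs ?_ hsT⟩
  have hHO : (fun x => H (B.symm (w x)) - H (B.symm L)) =O[atTop] fun x => Φ x ^ γ := by
    refine hH.isBigO_sub hBL hγ hγ1 (hHol.min_one hγ₁) hφ.tendsto_primitive hφ.primitive_pos ?_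
    have := (B.symm : EuclideanSpace ℝ (Fin n) →L[ℝ] EuclideanSpace ℝ (Fin n)).isBigO_comp
      (fun x => w x - L) atTop
    simpa using this.trans hLO
  have hwL : Tendsto w atTop (𝓝 L) := by
    simpa using (hLO.trans_tendsto hφ.tendsto_primitive).add_const L
  have hdL : diagForm d L = d k := by
    have h1 := diagForm_sub_eq (d := d) hL (d k)
    have h2 : ∑ i, (d i - d k) * L i ^ 2 = 0 := by
      refine Finset.sum_eq_zero fun i _ => ?_
      by_cases hi : d i = d k
      · simp [hi]
      · simp [hLk i hi]
    linarith
  have hqO : (fun x => inner ℝ (w x) (q x)) =O[atTop] Φ := by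
    refine IsBigO.trans (IsBigO.of_bound K ?_) hφ.isBigO_primitive
    filter_upwards [hw, hq, hφ.pos] with x h1 h2 h3
    rw [Real.norm_of_nonneg h3.le]
    exact (abs_inner_le_of_norm_eq_one h1).trans h2
  -- Since the form takes the value `d k` at `L`, this is a difference of squares, factored
  -- coordinatewise.
  have hformO : (fun x => diagForm d (w x) - d k) =O[atTop] Φ := by
    have h1 : (fun x => ∑ i, d i * ((w x i + L i) * (w x - L) i)) =O[atTop] Φ := by
      refine IsBigO.fun_sum fun i _ => IsBigO.const_mul_left ?_ _
      have h2 : (fun x => w x i + L i) =O[atTop] fun _ => (1 : ℝ) := by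
        refine IsBigO.of_bound 2 ?_
        filter_upwards [hw] with x hx
        refine (norm_add_le _ _).trans ?_
        have h3 := abs_apply_le_one hx i
        have h4 := abs_apply_le_one hL i
        rw [Real.norm_eq_abs, Real.norm_eq_abs]
        simp; linarith
      have h3 : (fun x => (w x - L) i) =O[atTop] Φ :=
        IsBigO.trans (IsBigO.of_bound 1 (Eventually.of_forall fun x => by
          rw [one_mul]; exact PiLp.norm_apply_le _ i)) hLO
      simpa using h2.mul h3
    refine h1.congr_left fun x => ?_
    rw [← hdL, diagForm, diagForm, ← Finset.sum_sub_distrib]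
    refine Finset.sum_congr rfl fun i _ => ?_
    simp; ring
  set p : ℝ → ℝ := fun x => H (B.symm (w x)) * (diagForm d (w x) + inner ℝ (w x) (q x)) with hp
  have hpO : (fun x => p x - H (B.symm L) * d k) =O[atTop] fun x => Φ x ^ γ := by
    have h1 : (fun x => (H (B.symm (w x)) - H (B.symm L)) * d k) =O[atTop] fun x => Φ x ^ γ := by
      simpa [mul_comm] using hHO.const_mul_left (d k)
    have h2 : (fun x => diagForm d (w x) - d k + inner ℝ (w x) (q x)) =O[atTop]
        fun x => Φ x ^ γ := (hformO.add hqO).trans hΦγ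
    have h3 : Tendsto (fun x => H (B.symm (w x))) atTop (𝓝 (H (B.symm L))) := by
      have := hHO.trans_tendsto (by
        have := hφ.tendsto_primitive.rpow_const (p := γ) (Or.inr hγ.le)
        rwa [Real.zero_rpow hγ.ne'] at this)
      simpa using this.add_const (H (B.symm L))
    have h4 := (h3.isBigO_one ℝ).mul h2
    simp only [one_mul] at h4
    refine (h1.add h4).congr_left fun x => ?_
    simp only [hp]; ring
  have hc : H (B.symm L) * d k ≠ 0 := (mul_pos (hH.pos hBL) (hm.trans_le (hd k))).ne'
  have hpT : Tendsto p atTop (𝓝 (H (B.symm L) * d k)) := by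
    have := hpO.trans_tendsto (by
      have := hφ.tendsto_primitive.rpow_const (p := γ) (Or.inr hγ.le)
      rwa [Real.zero_rpow hγ.ne'] at this)
    simpa using this.add_const (H (B.symm L) * d k)
  exact ((hasDerivAt_inv hc).isBigO_sub.comp_tendsto hpT).trans hpO

/-- The common core of the two cases, with the decay rate left abstract. The last conclusion, T - t
~ c e^(-αθ), is what later converts Φ(θ) into a function of T - t. -/
theorem exists_isBigO_profile {n : ℕ} {A : Matrix (Fin n) (Fin n) ℝ} {d : Fin n → ℝ}
    {m N α κ t₀ T : ℝ} {H : EuclideanSpace ℝ (Fin n) → ℝ}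
    {G : ℝ → EuclideanSpace ℝ (Fin n) → EuclideanSpace ℝ (Fin n)}
    {y : ℝ → EuclideanSpace ℝ (Fin n)}
    (hm : 0 < m) (hd : ∀ i, m ≤ d i) (hd' : ∀ i, d i ≤ N)
    (B : EuclideanSpace ℝ (Fin n) ≃L[ℝ] EuclideanSpace ℝ (Fin n))
    (hBA : ∀ x i, B (Matrix.toEuclideanLin A x) i = d i * B x i)
    (hα : 0 < α) (hH : IsRateFunction α H) (hHC : PropertyHC H (Metric.sphere 0 1))
    (hT : t₀ < T) (hy : IsBlowUpSolution A H G t₀ T y) {φ Φ : ℝ → ℝ}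
    (hφ : DecayRate κ φ Φ) (hκ : 0 < κ)
    (hgap : ∀ i j, d i ≠ d j → 8 * κ ≤ |d i / d j - 1|)
    (hG : ∃ K, ∀ᶠ t in 𝓝[<] T, ‖G t (y t)‖ ≤ K * (‖y t‖ ^ (1 + α) * φ (Real.log ‖B (y t)‖))) :
    ∃ (Λ : ℝ) (ξ : EuclideanSpace ℝ (Fin n)),
      Module.End.HasEigenvector (Matrix.toEuclideanLin A) Λ ξ ∧ α * Λ * H ξ = 1 ∧
      (∃ γ : ℝ, 0 < γ ∧ (fun t => (T - t) ^ (1 / α) • y t - ξ) =O[𝓝[<] T]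
        fun t => Φ (Real.log ‖B (y t)‖) ^ γ) ∧
      ∃ c, 0 < c ∧ Tendsto (fun t => (T - t) * Real.exp (α * Real.log ‖B (y t)‖))
        (𝓝[<] T) (𝓝 c) := by
  obtain ⟨K, hG⟩ := hG
  obtain ⟨c₁, hc₁, hHc⟩ := hH.exists_le
  set z : ℝ → EuclideanSpace ℝ (Fin n) := fun t => B (y t) with hz
  set θ : ℝ → ℝ := fun t => Real.log ‖z t‖ with hθ
  set h : ℝ → ℝ := fun t => H (y t) with hh
  -- The forcing relative to the main term; since H(y) ≥ c₁|y|^α, it is O(φ(θ)).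
  set q : ℝ → EuclideanSpace ℝ (Fin n) := fun t => (h t * ‖z t‖)⁻¹ • B (G t (y t)) with hqdef
  set w : ℝ → EuclideanSpace ℝ (Fin n) := fun t => ‖z t‖⁻¹ • z t with hwdef
  set θ' : ℝ → ℝ := fun t => h t * (diagForm d (w t) + inner ℝ (w t) (q t)) with hθ'
  have hIoo : ∀ᶠ t in 𝓝[<] T, t ∈ Ioo t₀ T := Ioo_mem_nhdsLT hT
  have hy0 : ∀ t ∈ Ioo t₀ T, y t ≠ 0 := fun t ht => hy.ne_zero t ⟨ht.1.le, ht.2⟩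
  have hz0 : ∀ t ∈ Ioo t₀ T, z t ≠ 0 := fun t ht => by simpa [hz] using hy0 t ht
  have hw1 : ∀ t ∈ Ioo t₀ T, ‖w t‖ = 1 := fun t ht => by
    simpa using norm_inv_smul_mem_sphere (hz0 t ht)
  have hθlim : Tendsto θ (𝓝[<] T) atTop := by
    refine Real.tendsto_log_atTop.comp ?_
    obtain ⟨C, hC, hCB⟩ : ∃ C > 0, ∀ x, C * ‖x‖ ≤ ‖B x‖ := by
      obtain ⟨C, hC, hCB⟩ := (B.symm : EuclideanSpace ℝ (Fin n) →L[ℝ] EuclideanSpace ℝ (Fin n)).bound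
      refine ⟨C⁻¹, inv_pos.2 hC, fun x => ?_⟩
      rw [inv_mul_le_iff₀ hC]
      simpa using hCB (B x)
    exact tendsto_atTop_mono (fun t => hCB (y t)) (hy.blowUp.const_mul_atTop hC)
  have hzd : ∀ t ∈ Ioo t₀ T, HasDerivAt z
      (B (h t • Matrix.toEuclideanLin A (y t) + G t (y t))) t := fun t ht =>
    (B : EuclideanSpace ℝ (Fin n) →L[ℝ] EuclideanSpace ℝ (Fin n)).hasFDerivAt.comp_hasDerivAt t (hy.hasDerivAt t ht)
  have hzq : ∀ t ∈ Ioo t₀ T, ∀ i, B (h t • Matrix.toEuclideanLin A (y t) + G t (y t)) i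
      = h t * (d i * z t i + ‖z t‖ * q t i) := by
    intro t ht i
    have h1 := (hH.pos (hy0 t ht)).ne'
    have h2 := norm_ne_zero_iff.2 (hz0 t ht)
    have h3 : h t ≠ 0 := h1
    simp only [map_add, map_smul, PiLp.add_apply, PiLp.smul_apply, hBA, smul_eq_mul, hqdef]
    field_simp
    rfl
  have hθd : ∀ t ∈ Ioo t₀ T, HasDerivAt θ (θ' t) t := fun t ht =>
    hasDerivAt_log_norm (hzd t ht) (hz0 t ht) (hzq t ht)
  have hwd : ∀ t ∈ Ioo t₀ T, ∀ i,
      HasDerivAt (fun t => w t i) (h t * (d i * w t i + q t i) - w t i * θ' t) t :=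
    fun t ht i => hasDerivAt_normalize_apply (hzd t ht) (hz0 t ht) (hzq t ht) (hθd t ht)
      (by filter_upwards [Ioo_mem_nhds ht.1 ht.2] with u hu using hz0 u hu) i
  set Nb : ℝ := ‖(B : EuclideanSpace ℝ (Fin n) →L[ℝ] EuclideanSpace ℝ (Fin n))‖ with hNb
  set Ns : ℝ := ‖(B.symm : EuclideanSpace ℝ (Fin n) →L[ℝ] EuclideanSpace ℝ (Fin n))‖ with hNs
  set K' : ℝ := Nb * |K| * Ns / c₁ with hK'
  have hq : ∀ᶠ t in 𝓝[<] T, ‖q t‖ ≤ K' * φ (θ t) := by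
    filter_upwards [hG, hIoo, hθlim.eventually hφ.pos] with t h1 h2 h3
    have h4 := hHc _ (hy0 t h2)
    have h5 : 0 < ‖y t‖ := norm_pos_iff.2 (hy0 t h2)
    have h6 : 0 < ‖z t‖ := norm_pos_iff.2 (hz0 t h2)
    have h7 : ‖B (G t (y t))‖ ≤ Nb * ‖G t (y t)‖ :=
      (B : EuclideanSpace ℝ (Fin n) →L[ℝ] EuclideanSpace ℝ (Fin n)).le_opNorm _
    have h8 : ‖y t‖ ≤ Ns * ‖z t‖ := by
      have := (B.symm : EuclideanSpace ℝ (Fin n) →L[ℝ] EuclideanSpace ℝ (Fin n)).le_opNorm (z t)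
      simpa [hz] using this
    have h9 : 0 < h t := hH.pos (hy0 t h2)
    have h10 : ‖G t (y t)‖ ≤ |K| * (‖y t‖ ^ α * ‖y t‖ * φ (θ t)) := by
      refine h1.trans ?_
      rw [add_comm 1 α, Real.rpow_add h5, Real.rpow_one]
      exact mul_le_mul_of_nonneg_right (le_abs_self K) (by positivity)
    have hb0 : 0 ≤ Nb := norm_nonneg _
    have hs0 : 0 ≤ Ns := norm_nonneg _
    simp only [hqdef]
    rw [norm_smul, norm_inv, Real.norm_of_nonneg (by positivity), inv_mul_le_iff₀ (by positivity)]
    calc ‖B (G t (y t))‖ ≤ Nb * (|K| * (‖y t‖ ^ α * (Ns * ‖z t‖) * φ (θ t))) := by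
          refine h7.trans (mul_le_mul_of_nonneg_left (h10.trans ?_) hb0)
          gcongr
      _ = c₁ * ‖y t‖ ^ α * ‖z t‖ * (K' * φ (θ t)) := by
          simp only [hK']; field_simp
      _ ≤ h t * ‖z t‖ * (K' * φ (θ t)) := by
          have : 0 ≤ K' * φ (θ t) := by positivity
          gcongr
  have hθpos : ∀ᶠ t in 𝓝[<] T, 0 < θ' t := by
    have h1 : Tendsto (fun t => K' * φ (θ t)) (𝓝[<] T) (𝓝 0) := by
      simpa using (hφ.tendsto.comp hθlim).const_mul K'
    filter_upwards [hq, hIoo, h1.eventually (gt_mem_nhds hm)] with t h2 h3 h4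
    refine mul_pos (hH.pos (hy0 t h3)) ?_
    have h5 := le_diagForm hd (hw1 t h3)
    have h6 := abs_inner_le_of_norm_eq_one (q := q t) (hw1 t h3)
    linarith [neg_abs_le (inner ℝ (w t) (q t))]
  obtain ⟨s, hsT, hs, hsθ⟩ := exists_inverse_of_tendsto_atTop
    (hIoo.mono fun t ht => hθd t ht) hθpos hθlim
  have hsI : ∀ᶠ x in atTop, s x ∈ Ioo t₀ T := hsT.eventually hIoo
  have hsy : ∀ᶠ x in atTop, y (s x) = Real.exp x • B.symm (w (s x)) := by
    filter_upwards [hs, hsI] with x h1 h2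
    have h3 : 0 < ‖z (s x)‖ := norm_pos_iff.2 (hz0 _ h2)
    have h4 : ‖z (s x)‖ = Real.exp x := by
      rw [← Real.exp_log h3]; exact congrArg _ h1.1
    simp only [hwdef, map_smul]
    rw [← h4, smul_smul, mul_inv_cancel₀ h3.ne', one_smul]
    simp [hz]
  obtain ⟨k, L, hL, hLk, γ, hγ, hwO, htO⟩ := exists_isBigO_normalized_flow (T := T) hm hd hd' hα hH
    hHC hφ hκ hgap B (w := fun x => w (s x)) (q := fun x => q (s x)) (s := s) (K := K')
    (hsI.mono fun x hx => hw1 _ hx)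
    (by filter_upwards [hsT.eventually hq, hs] with x h1 h2; rwa [h2.1] at h1)
    (by
      filter_upwards [hs, hsI, hsT.eventually hθpos] with x h1 h2 h3 i
      refine ((hwd _ h2 i).comp x h1.2).congr_deriv ?_
      have h4 : 0 < h (s x) := hH.pos (hy0 _ h2)
      have h5 : diagForm d (w (s x)) + inner ℝ (w (s x)) (q (s x)) ≠ 0 :=
        (pos_of_mul_pos_right h3 h4.le).ne'
      simp only [hθ']
      field_simp)
    (by
      filter_upwards [hs, hsI, hsy] with x h1 h2 h3
      refine h1.2.congr_deriv ?_
      have h4 : B.symm (w (s x)) ≠ 0 := by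
        have := hy0 _ h2
        rw [h3] at this
        exact right_ne_zero_of_smul this
      -- In the new clock |z| = e^x, so homogeneity isolates the factor e^(-αx) in the speed of `s`.
      have h5 : h (s x) = Real.exp (α * x) * H (B.symm (w (s x))) := by
        simp only [hh]
        rw [h3, hH.homogeneous _ h4 _ (Real.exp_pos x), ← Real.exp_mul, mul_comm x α, smul_eq_mul]
      simp only [hθ', h5]
      rw [neg_mul, Real.exp_neg, mul_assoc (Real.exp _), mul_inv])
    (tendsto_nhds_of_tendsto_nhdsWithin hsT)
  have hL0 : L ≠ 0 := by rintro rfl; simp at hL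
  have hx₀ : B.symm L ≠ 0 := by simpa using hL0
  set x₀ := B.symm L with hx₀def
  have hΛ : 0 < d k := hm.trans_le (hd k)
  have hHx : 0 < H x₀ := hH.pos hx₀
  set c : ℝ := (H x₀ * d k)⁻¹ / α with hc
  have hc0 : 0 < c := by positivity
  have heig : Matrix.toEuclideanLin A x₀ = d k • x₀ := by
    apply B.injective
    ext i
    rw [hBA, map_smul, PiLp.smul_apply, hx₀def, B.apply_symm_apply, smul_eq_mul]
    by_cases hi : d i = d k
    · rw [hi]
    · rw [hLk i hi]; simp
  have hΦγ : Tendsto (fun x => Φ x ^ γ) atTop (𝓝 0) := by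
    have := hφ.tendsto_primitive.rpow_const (p := γ) (Or.inr hγ.le)
    rwa [Real.zero_rpow hγ.ne'] at this
  have htlim : Tendsto (fun x => (T - s x) * Real.exp (α * x)) atTop (𝓝 c) := by
    simpa using (htO.trans_tendsto hΦγ).add_const c
  have hpow : (fun x => ((T - s x) * Real.exp (α * x)) ^ (1 / α) - c ^ (1 / α)) =O[atTop]
      fun x => Φ x ^ γ :=
    ((Real.hasDerivAt_rpow_const (p := 1 / α) (Or.inl hc0.ne')).isBigO_sub.comp_tendsto
      htlim).trans htO
  have hpowlim : Tendsto (fun x => ((T - s x) * Real.exp (α * x)) ^ (1 / α)) atTop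
      (𝓝 (c ^ (1 / α))) := htlim.rpow_const (Or.inl hc0.ne')
  have hBw : (fun x => B.symm (w (s x)) - x₀) =O[atTop] fun x => Φ x ^ γ := by
    have := (B.symm : EuclideanSpace ℝ (Fin n) →L[ℝ] EuclideanSpace ℝ (Fin n)).isBigO_comp
      (fun x => w (s x) - L) atTop
    simpa [hx₀def] using this.trans hwO
  have hprof : (fun x => (T - s x) ^ (1 / α) • y (s x) - c ^ (1 / α) • x₀) =O[atTop]
      fun x => Φ x ^ γ := by
    have h1 : (fun x => ((T - s x) * Real.exp (α * x)) ^ (1 / α) • (B.symm (w (s x)) - x₀))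
        =O[atTop] fun x => Φ x ^ γ := by
      simpa using (hpowlim.isBigO_one ℝ).smul hBw
    have h2 : (fun x => (((T - s x) * Real.exp (α * x)) ^ (1 / α) - c ^ (1 / α)) • x₀)
        =O[atTop] fun x => Φ x ^ γ := by
      simpa using hpow.smul (isBigO_refl (fun _ : ℝ => x₀) atTop |>.trans
        (isBigO_const_const x₀ (one_ne_zero (α := ℝ)) atTop))
    refine (h1.add h2).congr' ?_ EventuallyEq.rfl
    filter_upwards [hsy, hsI] with x h3 h4
    have h5 : ((T - s x) * Real.exp (α * x)) ^ (1 / α) = (T - s x) ^ (1 / α) * Real.exp x := by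
      rw [Real.mul_rpow (by linarith [h4.2]) (Real.exp_pos _).le, ← Real.exp_mul]
      congr 2
      field_simp
    rw [h3, h5, smul_smul, smul_sub, sub_smul]
    abel
  -- The power 1/α makes H(ξ) = cH(x₀), and c = 1/(αΛH(x₀)) gives the normalization.
  refine ⟨d k, c ^ (1 / α) • x₀, ⟨?_, ?_⟩, ?_, ⟨γ, hγ, ?_⟩, c, hc0, ?_⟩
  · rw [Module.End.mem_eigenspace_iff, map_smul, heig, smul_comm]
  · exact smul_ne_zero (by positivity) hx₀
  · rw [hH.homogeneous _ hx₀ _ (by positivity), ← Real.rpow_mul hc0.le, one_div_mul_cancel hα.ne',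
      Real.rpow_one, smul_eq_mul, hc]
    field_simp
  · refine (hprof.comp_tendsto hθlim).congr' ?_ EventuallyEq.rfl
    filter_upwards [hsθ] with t ht
    simp only [Function.comp, ht]
  · refine (htlim.comp hθlim).congr' ?_
    filter_upwards [hsθ] with t ht
    simp only [Function.comp, ht]
    rfl

/-! ### The exponential and the power decay rates. -/

theorem decayRate_exp {a κ : ℝ} (ha : 0 < a) (haκ : a ≤ κ) :
    DecayRate κ (fun x => Real.exp (-a * x)) (fun x => Real.exp (-a * x) / a) := by
  have hexp : ∀ x : ℝ, HasDerivAt (fun x => Real.exp (-a * x)) (Real.exp (-a * x) * (-a)) x := by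
    intro x
    simpa using ((hasDerivAt_id x).const_mul (-a)).exp
  have hlim : Tendsto (fun x : ℝ => Real.exp (-a * x)) atTop (𝓝 0) :=
    Real.tendsto_exp_atBot.comp (tendsto_id.const_mul_atTop_of_neg (by linarith))
  refine ⟨Eventually.of_forall fun x => Real.exp_pos _,
    ⟨_, Eventually.of_forall fun x => ⟨hexp x, ?_, ?_⟩⟩, Eventually.of_forall fun x => ?_, hlim,
    by simpa using hlim.div_const a, Eventually.of_forall fun x => by positivity, ?_⟩
  · nlinarith [Real.exp_pos (-a * x)]
  · nlinarith [Real.exp_pos (-a * x)]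
  · refine ((hexp x).div_const a).congr_deriv ?_
    field_simp
  · refine IsBigO.of_bound a (Eventually.of_forall fun x => ?_)
    rw [norm_div, Real.norm_of_nonneg ha.le]
    exact (mul_div_cancel₀ _ ha.ne').ge

/-- The logarithmic derivative -p/x eventually exceeds any -κ, so no smallness of `p` is required;
`p > 1` is integrability. -/
theorem decayRate_rpow {p κ : ℝ} (hp : 1 < p) (hκ : 0 < κ) :
    DecayRate κ (fun x => x ^ (-p)) (fun x => x ^ (-(p - 1)) / (p - 1)) := by
  have hp1 : 0 < p - 1 := by linarith
  have key : ∀ x : ℝ, 0 < x → x ^ (-(p - 1)) = x * x ^ (-p) := by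
    intro x hx
    rw [show -(p - 1) = 1 + -p by ring, Real.rpow_add hx, Real.rpow_one]
  refine ⟨?_, ⟨fun x => -p * x ^ (-p - 1), ?_⟩, ?_, tendsto_rpow_neg_atTop (by linarith),
    by simpa using (tendsto_rpow_neg_atTop hp1).div_const (p - 1), ?_, ?_⟩
  · filter_upwards [eventually_gt_atTop 0] with x hx using by positivity
  · filter_upwards [eventually_gt_atTop 0, eventually_ge_atTop (p / κ)] with x hx hxp
    refine ⟨Real.hasDerivAt_rpow_const (Or.inl hx.ne'), ?_, ?_⟩
    · rw [Real.rpow_sub_one hx.ne']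
      have h1 : 0 < x ^ (-p) := by positivity
      have h2 : p / x ≤ κ := by
        rw [div_le_iff₀ hκ] at hxp
        rw [div_le_iff₀ hx]; linarith
      have h3 : -p * (x ^ (-p) / x) = -(p / x * x ^ (-p)) := by ring
      rw [h3]
      exact neg_le_neg (mul_le_mul_of_nonneg_right h2 h1.le)
    · have : 0 < x ^ (-p - 1) := by positivity
      nlinarith
  · filter_upwards [eventually_gt_atTop 0] with x hx
    refine ((Real.hasDerivAt_rpow_const (p := -(p - 1)) (Or.inl hx.ne')).div_const
      (p - 1)).congr_deriv ?_
    rw [show -(p - 1) - 1 = -p by ring]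
    field_simp
  · filter_upwards [eventually_gt_atTop 0] with x hx using by positivity
  · refine IsBigO.of_bound (p - 1) ?_
    filter_upwards [eventually_ge_atTop 1] with x hx
    have hx0 : 0 < x := by linarith
    rw [norm_div, Real.norm_of_nonneg hp1.le, mul_div_cancel₀ _ hp1.ne', key x hx0, norm_mul,
      Real.norm_of_nonneg hx0.le]
    exact le_mul_of_one_le_left (norm_nonneg _) hx

/-! ### Diagonalizing coordinates and spectral constants. -/

theorem MatrixDiagonalizable.exists_equiv {n : ℕ} {A : Matrix (Fin n) (Fin n) ℝ}
    (hA : MatrixDiagonalizable A) :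
    ∃ (B : EuclideanSpace ℝ (Fin n) ≃L[ℝ] EuclideanSpace ℝ (Fin n)) (d : Fin n → ℝ),
      ∀ x i, B (Matrix.toEuclideanLin A x) i = d i * B x i := by
  obtain ⟨S, d, hS, rfl⟩ := hA
  have hdet : IsUnit S.det := (Matrix.isUnit_iff_isUnit_det S).1 hS
  have hmul : ∀ (M M' : Matrix (Fin n) (Fin n) ℝ) x,
      Matrix.toEuclideanLin M (Matrix.toEuclideanLin M' x) = Matrix.toEuclideanLin (M * M') x := by
    intro M M' x
    simp [Matrix.toLpLin_apply, Matrix.mulVec_mulVec]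
  have hone : ∀ x : EuclideanSpace ℝ (Fin n), Matrix.toEuclideanLin 1 x = x := by
    intro x
    simp
  let e : EuclideanSpace ℝ (Fin n) ≃ₗ[ℝ] EuclideanSpace ℝ (Fin n) :=
    LinearEquiv.ofLinearMap (Matrix.toEuclideanLin S) (Matrix.toEuclideanLin S⁻¹)
      (LinearMap.ext fun x => by
        rw [LinearMap.comp_apply, hmul, Matrix.mul_nonsing_inv S hdet, hone, LinearMap.id_apply])
      (LinearMap.ext fun x => by
        rw [LinearMap.comp_apply, hmul, Matrix.nonsing_inv_mul S hdet, hone, LinearMap.id_apply])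
  refine ⟨e.toContinuousLinearEquiv, d, fun x i => ?_⟩
  change Matrix.toEuclideanLin S (Matrix.toEuclideanLin (S⁻¹ * Matrix.diagonal d * S) x) i
    = d i * Matrix.toEuclideanLin S x i
  rw [hmul, Matrix.mul_assoc, Matrix.mul_nonsing_inv_cancel_left S _ hdet]
  simp [Matrix.toLpLin_apply, -Matrix.mulVec_mulVec, Matrix.mulVec_diagonal]

/-- Each `d i` is an eigenvalue, with eigenvector the preimage under `B` of the i-th basis vector.
-/
theorem DiagonalizablePositive.exists_equiv {n : ℕ} {A : Matrix (Fin n) (Fin n) ℝ}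
    (hA : DiagonalizablePositive A) :
    ∃ (B : EuclideanSpace ℝ (Fin n) ≃L[ℝ] EuclideanSpace ℝ (Fin n)) (d : Fin n → ℝ),
      (∀ i, 0 < d i) ∧ ∀ x i, B (Matrix.toEuclideanLin A x) i = d i * B x i := by
  obtain ⟨B, d, hB⟩ := hA.1.exists_equiv
  refine ⟨B, d, fun i => hA.2 _ (Module.End.hasEigenvalue_of_hasEigenvector
    (x := B.symm (EuclideanSpace.single i 1)) ⟨?_, ?_⟩), hB⟩
  · rw [Module.End.mem_eigenspace_iff]
    apply B.injective
    ext j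
    rw [hB, map_smul, PiLp.smul_apply, B.apply_symm_apply, smul_eq_mul]
    by_cases hj : j = i
    · rw [hj]
    · simp [hj]
  · simp

theorem exists_bounds_of_pos {ι : Type*} [Finite ι] {d : ι → ℝ} (hd : ∀ i, 0 < d i) :
    ∃ m N κ : ℝ, 0 < m ∧ 0 < κ ∧ (∀ i, m ≤ d i) ∧ (∀ i, d i ≤ N) ∧
      ∀ i j, d i ≠ d j → 8 * κ ≤ |d i / d j - 1| := by
  rcases isEmpty_or_nonempty ι with h | h
  · exact ⟨1, 1, 1, one_pos, one_pos, fun i => h.elim i, fun i => h.elim i, fun i => h.elim i⟩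
  obtain ⟨i₀, h₀⟩ := Finite.exists_min d
  obtain ⟨i₁, h₁⟩ := Finite.exists_max d
  obtain ⟨κ, hκ, hgap⟩ : ∃ κ > 0, ∀ p : ι × ι, d p.1 ≠ d p.2 → κ ≤ |d p.1 / d p.2 - 1| := by
    -- Pairs with equal entries receive the dummy value 1, so the minimum over all pairs is
    -- positive.
    obtain ⟨p, hp⟩ := Finite.exists_min fun p : ι × ι =>
      if d p.1 = d p.2 then 1 else |d p.1 / d p.2 - 1|
    refine ⟨_, ?_, fun q hq => (hp q).trans (by simp [hq])⟩
    split_ifs with h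
    · exact one_pos
    · refine abs_pos.2 fun h' => h ?_
      rwa [sub_eq_zero, div_eq_one_iff_eq (hd _).ne'] at h'
  refine ⟨d i₀, d i₁, κ / 8, hd i₀, by positivity, h₀, h₁, fun i j hij => ?_⟩
  have := hgap (i, j) hij
  linarith

/-! ### The two cases. -/

theorem mainTheorem8 (n : ℕ) (hn : 1 ≤ n)
    (A : Matrix (Fin n) (Fin n) ℝ) (hA : DiagonalizablePositive A)
    (α : ℝ) (hα : 0 < α)
    (H : EuclideanSpace ℝ (Fin n) → ℝ) (hH : IsRateFunction α H)
    (t₀ T : ℝ) (ht₀ : 0 ≤ t₀) (hT : t₀ < T)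
    (G : ℝ → EuclideanSpace ℝ (Fin n) → EuclideanSpace ℝ (Fin n))
    (y : ℝ → EuclideanSpace ℝ (Fin n)) (hy : IsBlowUpSolution A H G t₀ T y) :
    (PowerCase α t₀ H G →
      ∃ (Λ : ℝ) (ξ : EuclideanSpace ℝ (Fin n)),
        Module.End.HasEigenvector (Matrix.toEuclideanLin A) Λ ξ ∧
        α * Λ * H ξ = 1 ∧
        ∃ ε : ℝ, 0 < ε ∧
          (fun t => (T - t) ^ (1 / α) • y t - ξ) =O[𝓝[<] T] (fun t => (T - t) ^ ε)) ∧
    (LogCase α t₀ H G →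
      ∃ (Λ : ℝ) (ξ : EuclideanSpace ℝ (Fin n)),
        Module.End.HasEigenvector (Matrix.toEuclideanLin A) Λ ξ ∧
        α * Λ * H ξ = 1 ∧
        ∃ p : ℝ, 0 < p ∧
          (fun t => (T - t) ^ (1 / α) • y t - ξ) =O[𝓝[<] T]
            (fun t => |Real.log (T - t)| ^ (-p))) := by
  obtain ⟨B, d, hd, hBA⟩ := hA.exists_equiv
  obtain ⟨m, N, κ, hm, hκ, hmd, hdN, hgap⟩ := exists_bounds_of_pos hd
  obtain ⟨C, hC, hBC⟩ :=
    (B : EuclideanSpace ℝ (Fin n) →L[ℝ] EuclideanSpace ℝ (Fin n)).bound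
  obtain ⟨C', hC', hBC'⟩ :=
    (B.symm : EuclideanSpace ℝ (Fin n) →L[ℝ] EuclideanSpace ℝ (Fin n)).bound
  have hlog : Tendsto (fun t => Real.log ‖B (y t)‖) (𝓝[<] T) atTop := by
    refine Real.tendsto_log_atTop.comp
      (tendsto_atTop_mono (fun t => ?_) (hy.blowUp.const_mul_atTop (inv_pos.2 hC')))
    rw [inv_mul_le_iff₀ hC']
    simpa using hBC' (B (y t))
  have hlow : ∀ t, 0 < ‖y t‖ → 0 < ‖B (y t)‖ := fun t ht => by
    rw [norm_pos_iff] at ht ⊢; simpa using ht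
  have htT : ∀ᶠ t in 𝓝[<] T, t ∈ Ioo t₀ T := Ioo_mem_nhdsLT hT
  constructor
  · rintro ⟨hHC, -, M, δ, r, hM, hδ, hr, hG⟩
    -- Lowering δ weakens the bound on `G` but keeps φ from decaying faster than the spectral gap
    -- allows.
    set a := min δ κ with ha
    have ha0 : 0 < a := lt_min hδ hκ
    obtain ⟨Λ, ξ, hξ, hΛ, ⟨γ, hγ, hO⟩, c, hc, hlim⟩ := exists_isBigO_profile hm hmd hdN B hBA hα hH
      hHC hT hy (decayRate_exp ha0 (min_le_right δ κ)) hκ hgap ⟨M * C ^ a, by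
        filter_upwards [hy.blowUp.eventually_ge_atTop r, htT] with t h1 h2
        have h3 : 0 < ‖y t‖ := by linarith
        have h4 := hlow t h3
        have h5 : ‖B (y t)‖ ≤ C * ‖y t‖ := hBC (y t)
        refine (hG t h2.1.le _ h1).trans ?_
        rw [sub_eq_add_neg, Real.rpow_add h3, mul_assoc, mul_left_comm (C ^ a)]
        refine mul_le_mul_of_nonneg_left (mul_le_mul_of_nonneg_left ?_ (by positivity)) hM.le
        have h6 : Real.exp (-a * Real.log ‖B (y t)‖) = ‖B (y t)‖ ^ (-a) := by
          rw [Real.rpow_def_of_pos h4, mul_comm]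
        rw [h6]
        calc ‖y t‖ ^ (-δ) ≤ ‖y t‖ ^ (-a) :=
              Real.rpow_le_rpow_of_exponent_le (by linarith) (neg_le_neg (min_le_left _ _))
          _ = C ^ a * (C * ‖y t‖) ^ (-a) := by
              rw [Real.mul_rpow hC.le h3.le, ← mul_assoc, ← Real.rpow_add hC]
              simp
          _ ≤ C ^ a * ‖B (y t)‖ ^ (-a) := by
              refine mul_le_mul_of_nonneg_left ?_ (by positivity)
              exact Real.rpow_le_rpow_of_nonpos h4 h5 (by linarith)⟩
    -- Here Φ^γ is a multiple of e^(-aγθ) = (e^(-αθ))^(aγ/α), and eventually e^(-αθ) ≤ (2/c)(T - t).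
    refine ⟨Λ, ξ, hξ, hΛ, a * γ / α, by positivity, hO.trans ?_⟩
    refine IsBigO.of_bound ((2 / c) ^ (a * γ / α) / a ^ γ) ?_
    filter_upwards [htT, hlim.eventually (lt_mem_nhds (half_lt_self hc))] with t h1 h2
    have h3 : 0 < T - t := by linarith [h1.2]
    set u := Real.log ‖B (y t)‖
    have h4 : Real.exp (-α * u) ≤ 2 / c * (T - t) := by
      rw [neg_mul, Real.exp_neg, inv_le_iff_one_le_mul₀ (Real.exp_pos _), mul_assoc,
        div_mul_eq_mul_div, le_div_iff₀ hc]
      linarith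
    have h5 : (Real.exp (-a * u) / a) ^ γ = Real.exp (-α * u) ^ (a * γ / α) / a ^ γ := by
      rw [Real.div_rpow (Real.exp_pos _).le ha0.le, ← Real.exp_mul, ← Real.exp_mul]
      congr 2
      field_simp
    rw [Real.norm_of_nonneg (by positivity), Real.norm_of_nonneg (by positivity), h5,
      div_mul_eq_mul_div, ← Real.mul_rpow (by positivity) h3.le]
    gcongr
  · rintro ⟨γ₀, hγ₀, -, hHC, -, M, r, p, hM, hr, hp, hG⟩
    have hp1 : 1 < p := by
      have : 0 < 1 / γ₀ := by positivity
      linarith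
    have hp1' : 0 < p - 1 := by linarith
    obtain ⟨Λ, ξ, hξ, hΛ, ⟨γ, hγ, hO⟩, c, hc, hlim⟩ := exists_isBigO_profile hm hmd hdN B hBA hα hH
      (fun x hx => ⟨γ₀, hγ₀, hHC x hx⟩) hT hy (decayRate_rpow hp1 hκ) hκ hgap ⟨M * 2 ^ p, by
        filter_upwards [hy.blowUp.eventually_ge_atTop r, htT,
          hlog.eventually_ge_atTop (2 * Real.log C), hlog.eventually_gt_atTop 0] with t h1 h2 h3 h4
        have h5 : 0 < ‖y t‖ := lt_of_lt_of_le ((Real.exp_pos 1).trans hr) h1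
        have h6 : Real.log ‖B (y t)‖ ≤ Real.log C + Real.log ‖y t‖ := by
          rw [← Real.log_mul hC.ne' h5.ne']
          exact Real.log_le_log (hlow t h5) (hBC (y t))
        refine (hG t h2.1.le _ h1).trans ?_
        -- Once θ ≥ 2 log C, the distortion by `B` costs at most half of the logarithm, hence the
        -- factor 2^p.
        have h7 : Real.log ‖B (y t)‖ / 2 ≤ Real.log ‖y t‖ := by linarith
        set u := Real.log ‖B (y t)‖
        have h8 : (u / 2) ^ p ≤ Real.log ‖y t‖ ^ p :=
          Real.rpow_le_rpow (by positivity) h7 (by linarith)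
        calc M * ‖y t‖ ^ (1 + α) / Real.log ‖y t‖ ^ p
            ≤ M * ‖y t‖ ^ (1 + α) / (u / 2) ^ p := by gcongr
          _ = M * 2 ^ p * (‖y t‖ ^ (1 + α) * u ^ (-p)) := by
              rw [Real.div_rpow h4.le zero_le_two, Real.rpow_neg h4.le]
              field_simp⟩
    refine ⟨Λ, ξ, hξ, hΛ, (p - 1) * γ, by positivity, hO.trans ?_⟩
    refine IsBigO.of_bound ((2 * α) ^ ((p - 1) * γ) / (p - 1) ^ γ) ?_
    have hloglim := (Real.continuousAt_log hc.ne').tendsto.comp hlim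
    have hbd := (hloglim.abs).eventually (gt_mem_nhds (lt_add_one |Real.log c|))
    filter_upwards [htT, hbd, hlog.eventually_gt_atTop 0,
      hlog.eventually_gt_atTop ((|Real.log c| + 1) / α)] with t h1 h2 h3 h4
    have h5 : 0 < T - t := by linarith [h1.2]
    set u := Real.log ‖B (y t)‖
    simp only [Function.comp] at h2
    rw [Real.log_mul h5.ne' (Real.exp_pos _).ne', Real.log_exp] at h2
    rw [div_lt_iff₀ hα] at h4
    obtain ⟨h6, h7⟩ := abs_lt.1 h2
    -- Since log(T - t) + αθ → log c, the bounded remainder is eventually below αθ.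
    have h8 : |Real.log (T - t)| ≤ 2 * α * u := abs_le.2 ⟨by linarith, by nlinarith⟩
    have h9 : 0 < |Real.log (T - t)| := abs_pos.2 (by intro h; linarith)
    have h10 : (u ^ (-(p - 1)) / (p - 1)) ^ γ
        = (2 * α) ^ ((p - 1) * γ) / (p - 1) ^ γ * (2 * α * u) ^ (-((p - 1) * γ)) := by
      rw [Real.div_rpow (by positivity) hp1'.le, ← Real.rpow_mul h3.le,
        Real.mul_rpow (by positivity) h3.le, Real.rpow_neg (by positivity : 0 ≤ 2 * α), neg_mul]
      field_simp
    rw [Real.norm_of_nonneg (by positivity), Real.norm_of_nonneg (by positivity), h10]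
    refine mul_le_mul_of_nonneg_left ?_ (by positivity)
    exact Real.rpow_le_rpow_of_nonpos h9 h8 (by nlinarith)
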